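/- Definitions. For an integer $r\ge 1$ let $$H^r(\mathbb Z)=\langle \alpha,\beta,\gamma \mid \alpha\beta\alpha^{-1}\beta^{-1}=\gamma^r,\ \alpha\gamma=\gamma\alpha,\ \beta\gamma=\gamma\beta\rangle .$$ A *discrete Heisenberg group* is a group isomorphic to $H^r(\mathbb Z)$ for some $r\ge 1$. A *discrete split oscillator group* is a group isomorphic to a semidirect product $H_d\rtimes_\phi \mathbb Z\delta$ of a discrete Heisenberg group $H_d$ with an infinite cyclic group generated by $\delta$, such that the automorphism of $H_d/Z(H_d)\cong\mathbb Z^2$ induced by $\phi(\delta)$ is conjugate in $\mathrm{GL}(2,\mathbb R)$ to a hyperbolic rotation, i.e. to a matrix $\begin{pmatrix}\cosh s&\sinh s\\ \sinh s&\cosh s\end{pmatrix}$ with $s\neq 0$. For $r\ge 1$, $B=\begin{pmatrix}a&b\\c&d\end{pmatrix}\in \mathrm{SL}(2,\mathbb Z)$ with $\operatorname{tr}B>2$ and $l=(l_1,l_2)\in\mathbb Z^2$ let $\mathrm{Osc}^r(B,l)=H^r(\mathbb Z)\rtimes_\phi\mathbb Z\delta$ with $\phi(\delta)(\alpha)=\alpha^a\beta^c\gamma^{-l_2}$,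 $\phi(\delta)(\beta)=\alpha^b\beta^d\gamma^{l_1}$, $\phi(\delta)(\gamma)=\gamma$ (up to isomorphism this depends only on $l$ modulo $r$). Two groups are *abstractly commensurable* if they have isomorphic subgroups of finite index. A *real quadratic field* is a subfield of $\mathbb R$ of degree $2$ over $\mathbb Q$. Theorem. In the following, $B$, $B_1$, $B_2$ are elements of $\mathrm{SL}(2,\mathbb Z)$ of trace greater than $2$, $r,r_1,r_2\ge1$ are integers and $l,l_1,l_2\in\mathbb Z^2$. 1. A group is a discrete split oscillator group if and only if it is isomorphic to $\mathrm{Osc}^r(B,l)$ for some $r$, $B$, $l$. 2. For $B$ as above let $\lambda(B)\in\mathbb R$ be any of the two eigenvalues of $B$. The assignment $\mathrm{Osc}^r(B,l)\mapsto \mathbb Q(\lambda(B))$ induces a well-defined bijection from the set of abstract commensurability classes of discrete split oscillator groups to the set of real quadratic fields. 3. The groups $\mathrm{Osc}^{r_1}(B_1,l_1)$ and $\mathrm{Osc}^{r_2}(B_2,l_2)$ are abstractly commensurable if and only if there are nonzero integers $m,n$ and a matrix $M\in\mathrm{GL}(2,\mathbb Q)$ such that $B_1^m=MB_2^nM^{-1}$.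 -/

import Mathlib

namespace SplitOsc

/-! ### Discrete Heisenberg groups -/

/-- The relators of `⟨α, β, γ ∣ αβα⁻¹β⁻¹ = γ ^ r, αγ = γα, βγ = γβ⟩`,
with `α, β, γ` indexed by `0, 1, 2`. -/
def heisRels (r : ℕ) : Set (FreeGroup (Fin 3)) :=
  let a := FreeGroup.of (0 : Fin 3)
  let b := FreeGroup.of (1 : Fin 3)
  let c := FreeGroup.of (2 : Fin 3)
  {a * b * a⁻¹ * b⁻¹ * (c ^ r)⁻¹, a * c * (c * a)⁻¹, b * c * (c * b)⁻¹}

/-- The group `H^r(ℤ) = ⟨α, β, γ ∣ αβα⁻¹β⁻¹ = γ ^ r, αγ = γα, βγ = γβ⟩`. -/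
abbrev Heis (r : ℕ) : Type := PresentedGroup (heisRels r)

/-- The generator `α` of `H^r(ℤ)`. -/
def hα (r : ℕ) : Heis r := PresentedGroup.of 0

/-- The generator `β` of `H^r(ℤ)`. -/
def hβ (r : ℕ) : Heis r := PresentedGroup.of 1

/-- The generator `γ` of `H^r(ℤ)`. -/
def hγ (r : ℕ) : Heis r := PresentedGroup.of 2

/-- The relations hold for the images of the generators under `f`. -/
theorem lift_rels {r : ℕ} {G : Type*} [Group G] {f : Fin 3 → G}
    (h1 : f 0 * f 1 * (f 0)⁻¹ * (f 1)⁻¹ = f 2 ^ r) (h2 : f 0 * f 2 = f 2 * f 0)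
    (h3 : f 1 * f 2 = f 2 * f 1) : ∀ w ∈ heisRels r, FreeGroup.lift f w = 1 := by
  intro w hw
  simp only [heisRels, Set.mem_insert_iff, Set.mem_singleton_iff] at hw
  rcases hw with rfl | rfl | rfl
  · simp [h1]
  · simp [h2]
  · simp [h3]

theorem rel_ab (r : ℕ) : hα r * hβ r * (hα r)⁻¹ * (hβ r)⁻¹ = hγ r ^ r := by
  have : (PresentedGroup.mk (heisRels r)) (FreeGroup.of 0 * FreeGroup.of 1 * (FreeGroup.of 0)⁻¹ *
      (FreeGroup.of 1)⁻¹ * (FreeGroup.of 2 ^ r)⁻¹) = 1 :=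
    PresentedGroup.one_of_mem (by simp [heisRels])
  simp only [map_mul, map_inv, map_pow] at this
  exact mul_inv_eq_one.1 this

theorem rel_ac (r : ℕ) : hα r * hγ r = hγ r * hα r := by
  have : (PresentedGroup.mk (heisRels r)) (FreeGroup.of 0 * FreeGroup.of 2 *
      (FreeGroup.of 2 * FreeGroup.of 0)⁻¹) = 1 :=
    PresentedGroup.one_of_mem (by simp [heisRels])
  simp only [map_mul, map_inv] at this
  exact mul_inv_eq_one.1 (by simpa [hα, hγ, PresentedGroup.of] using this)

theorem rel_bc (r : ℕ) : hβ r * hγ r = hγ r * hβ r := by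
  have : (PresentedGroup.mk (heisRels r)) (FreeGroup.of 1 * FreeGroup.of 2 *
      (FreeGroup.of 2 * FreeGroup.of 1)⁻¹) = 1 :=
    PresentedGroup.one_of_mem (by simp [heisRels])
  simp only [map_mul, map_inv] at this
  exact mul_inv_eq_one.1 (by simpa [hβ, hγ, PresentedGroup.of] using this)

/-- Normal forms: `(x, y, z)` stands for `α ^ x * β ^ y * γ ^ z`. -/
@[ext] structure Model (r : ℕ) where
  x : ℤ
  y : ℤ
  z : ℤ

namespace Model

variable {r : ℕ}

instance : Mul (Model r) := ⟨fun g h => ⟨g.x + h.x, g.y + h.y, g.z + h.z - r * g.y * h.x⟩⟩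
instance : One (Model r) := ⟨⟨0, 0, 0⟩⟩
instance : Inv (Model r) := ⟨fun g => ⟨-g.x, -g.y, -g.z - r * g.y * g.x⟩⟩

@[simp] theorem mul_x (g h : Model r) : (g * h).x = g.x + h.x := rfl
@[simp] theorem mul_y (g h : Model r) : (g * h).y = g.y + h.y := rfl
@[simp] theorem mul_z (g h : Model r) : (g * h).z = g.z + h.z - r * g.y * h.x := rfl
@[simp] theorem one_x : (1 : Model r).x = 0 := rfl
@[simp] theorem one_y : (1 : Model r).y = 0 := rfl
@[simp] theorem one_z : (1 : Model r).z = 0 := rfl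
@[simp] theorem inv_x (g : Model r) : (g⁻¹).x = -g.x := rfl
@[simp] theorem inv_y (g : Model r) : (g⁻¹).y = -g.y := rfl
@[simp] theorem inv_z (g : Model r) : (g⁻¹).z = -g.z - r * g.y * g.x := rfl

instance : Group (Model r) :=
  Group.ofLeftAxioms
    (fun a b c => by ext <;> simp <;> ring)
    (fun a => by ext <;> simp)
    (fun a => by ext <;> simp; ring)

/-- `n (n - 1) / 2`. -/
def tri (n : ℤ) : ℤ := n * (n - 1) / 2

theorem two_tri (n : ℤ) : 2 * tri n = n * (n - 1) := by
  have h : 2 ∣ n * (n - 1) := by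
    rcases Int.even_or_odd n with h | h
    · exact h.two_dvd.mul_right _
    · exact (h.sub_odd odd_one).two_dvd.mul_left _
  exact Int.mul_ediv_cancel' h

theorem tri_add (m n : ℤ) : tri (m + n) = tri m + tri n + m * n := by
  have h1 := two_tri m
  have h2 := two_tri n
  have h3 := two_tri (m + n)
  have : 2 * tri (m + n) = 2 * (tri m + tri n + m * n) := by rw [h3, mul_add, mul_add, h1, h2]; ring
  linarith

theorem tri_zero : tri 0 = 0 := rfl
theorem tri_one : tri 1 = 0 := rfl
theorem tri_neg_one : tri (-1) = 1 := rfl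

theorem zpow_eq (g : Model r) (n : ℤ) :
    g ^ n = ⟨n * g.x, n * g.y, n * g.z - r * g.x * g.y * tri n⟩ := by
  induction n using Int.induction_on with
  | zero => simp [tri_zero]; rfl
  | succ n ih =>
    rw [zpow_add_one, ih]
    ext <;> simp [tri_add, tri_one] <;> ring
  | pred n ih =>
    rw [sub_eq_add_neg, zpow_add, ih, zpow_neg_one]
    ext <;> simp [tri_add, tri_neg_one] <;> ring

end Model

open Model in
/-- The homomorphism onto the group of normal forms. -/
def toModel (r : ℕ) : Heis r →* Model r :=
  PresentedGroup.toGroup (f := ![⟨1, 0, 0⟩, ⟨0, 1, 0⟩, ⟨0, 0, 1⟩])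
    (lift_rels (by rw [← zpow_natCast, zpow_eq]; ext <;> simp [tri]) (by ext <;> simp)
      (by ext <;> simp))

theorem toModel_α (r : ℕ) : toModel r (hα r) = ⟨1, 0, 0⟩ := PresentedGroup.toGroup.of _
theorem toModel_β (r : ℕ) : toModel r (hβ r) = ⟨0, 1, 0⟩ := PresentedGroup.toGroup.of _
theorem toModel_γ (r : ℕ) : toModel r (hγ r) = ⟨0, 0, 1⟩ := PresentedGroup.toGroup.of _

theorem toModel_normal (r : ℕ) (x y z : ℤ) :
    toModel r (hα r ^ x * hβ r ^ y * hγ r ^ z) = ⟨x, y, z⟩ := by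
  simp only [map_mul, map_zpow, toModel_α, toModel_β, toModel_γ, Model.zpow_eq]
  ext <;> simp

theorem commute_zpow (r : ℕ) (x y : ℤ) :
    hβ r ^ y * hα r ^ x = hα r ^ x * hβ r ^ y * hγ r ^ (-(r * y * x)) := by
  have cac : Commute (hα r) (hγ r) := rel_ac r
  have cbc : Commute (hβ r) (hγ r) := rel_bc r
  have h1 : hα r * hβ r * (hα r)⁻¹ = hγ r ^ (r : ℤ) * hβ r := by
    rw [zpow_natCast, ← rel_ab]; group
  have h2 : hα r * hβ r ^ y * (hα r)⁻¹ = hγ r ^ ((r : ℤ) * y) * hβ r ^ y := by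
    rw [← conj_zpow, h1, (cbc.symm.zpow_left _).mul_zpow, zpow_mul]
  have h3 : (hβ r ^ y)⁻¹ * hα r * ((hβ r ^ y)⁻¹)⁻¹ = hγ r ^ ((r : ℤ) * y) * hα r := by
    have h4 : hα r * hβ r ^ y = hγ r ^ ((r : ℤ) * y) * hβ r ^ y * hα r := by rw [← h2]; group
    rw [inv_inv, mul_assoc, h4, ← ((cbc.zpow_left y).zpow_right ((r : ℤ) * y)).eq]; group
  have h5 : (hβ r ^ y)⁻¹ * hα r ^ x * ((hβ r ^ y)⁻¹)⁻¹ = hγ r ^ ((r : ℤ) * y * x) * hα r ^ x := by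
    rw [← conj_zpow, h3, (cac.symm.zpow_left _).mul_zpow, ← zpow_mul]
  have h6 : hα r ^ x * hβ r ^ y = hβ r ^ y * (hγ r ^ ((r : ℤ) * y * x) * hα r ^ x) := by
    rw [← h5]; group
  rw [h6, ← ((cac.zpow_left x).zpow_right ((r : ℤ) * y * x)).eq]; group

/-- `(x, y, z) ↦ α ^ x * β ^ y * γ ^ z`. -/
def ofModel (r : ℕ) : Model r →* Heis r :=
  MonoidHom.mk' (fun g => hα r ^ g.x * hβ r ^ g.y * hγ r ^ g.z) (by
    intro g h
    have cac : ∀ m n : ℤ, hγ r ^ m * hα r ^ n = hα r ^ n * hγ r ^ m := fun m n =>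
      (((show Commute (hα r) (hγ r) from rel_ac r).symm.zpow_left m).zpow_right n).eq
    have cbc : ∀ m n : ℤ, hγ r ^ m * hβ r ^ n = hβ r ^ n * hγ r ^ m := fun m n =>
      (((show Commute (hβ r) (hγ r) from rel_bc r).symm.zpow_left m).zpow_right n).eq
    simp only [Model.mul_x, Model.mul_y, Model.mul_z]
    calc hα r ^ (g.x + h.x) * hβ r ^ (g.y + h.y) * hγ r ^ (g.z + h.z - r * g.y * h.x)
        = hα r ^ g.x * (hα r ^ h.x * (hβ r ^ g.y * (hβ r ^ h.y * hγ r ^ (-(r * g.y * h.x)))))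
            * (hγ r ^ g.z * hγ r ^ h.z) := by
          rw [sub_eq_add_neg, add_comm, zpow_add (hγ r), zpow_add (hγ r), zpow_add, zpow_add]
          group
      _ = hα r ^ g.x * (hβ r ^ g.y * hα r ^ h.x) * (hβ r ^ h.y * hγ r ^ g.z) * hγ r ^ h.z := by
          rw [← cbc, commute_zpow]; simp only [mul_assoc]
      _ = hα r ^ g.x * hβ r ^ g.y * (hα r ^ h.x * hγ r ^ g.z) * hβ r ^ h.y * hγ r ^ h.z := by
          rw [← cbc]; simp only [mul_assoc]
      _ = _ := by rw [← cac]; simp only [mul_assoc])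

theorem ofModel_toModel (r : ℕ) (h : Heis r) : ofModel r (toModel r h) = h := by
  have : (ofModel r).comp (toModel r) = MonoidHom.id _ := by
    apply PresentedGroup.ext
    intro i
    fin_cases i
    · change ofModel r (toModel r (hα r)) = hα r
      rw [toModel_α]; simp [ofModel]
    · change ofModel r (toModel r (hβ r)) = hβ r
      rw [toModel_β]; simp [ofModel]
    · change ofModel r (toModel r (hγ r)) = hγ r
      rw [toModel_γ]; simp [ofModel]
  exact DFunLike.congr_fun this h

/-- Every element of `H^r(ℤ)` is uniquely of the form `α ^ x * β ^ y * γ ^ z`. -/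
def heisEquiv (r : ℕ) : Heis r ≃* Model r where
  toFun := toModel r
  invFun := ofModel r
  left_inv := ofModel_toModel r
  right_inv := fun g => toModel_normal r g.x g.y g.z
  map_mul' := map_mul _

theorem heisEquiv_apply (r : ℕ) (h : Heis r) : heisEquiv r h = toModel r h := rfl

/-- A discrete Heisenberg group is a group isomorphic to `H^r(ℤ)` for some `r > 0`. -/
def IsDiscreteHeisenberg (H : Type*) [Group H] : Prop :=
  ∃ r : ℕ, 0 < r ∧ Nonempty (H ≃* Heis r)

/-! ### Discrete split oscillator groups -/

/-- An integer matrix is conjugate in `GL(2, ℝ)` to a hyperbolic rotation, that is, to an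
element of `SO⁺(1,1)` other than the identity. -/
def IsConjHyperbolicRotation (B : Matrix (Fin 2) (Fin 2) ℤ) : Prop :=
  ∃ s : ℝ, s ≠ 0 ∧ ∃ P : GL (Fin 2) ℝ,
    B.map (Int.cast : ℤ → ℝ) =
      (P : Matrix (Fin 2) (Fin 2) ℝ) *
        !![Real.cosh s, Real.sinh s; Real.sinh s, Real.cosh s] *
        ((P⁻¹ : GL (Fin 2) ℝ) : Matrix (Fin 2) (Fin 2) ℝ)

/-- The automorphism of `H / Z(H)` induced by `f` is given, with respect to some isomorphism
`e : H / Z(H) ≅ ℤ²`, by a matrix that is conjugate in `GL(2, ℝ)` to a hyperbolic rotation. -/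
def InducesHyperbolicRotation {H : Type*} [Group H] (f : MulAut H) : Prop :=
  ∃ (e : H ⧸ Subgroup.center H ≃* Multiplicative (Fin 2 → ℤ)) (B : Matrix (Fin 2) (Fin 2) ℤ),
    (∀ h : H, (e (QuotientGroup.mk (f h))).toAdd = B.mulVec (e (QuotientGroup.mk h)).toAdd) ∧
      IsConjHyperbolicRotation B

/-- A discrete split oscillator group is a semidirect product `H ⋊ ℤδ` of a discrete Heisenberg
group `H` with an infinite cyclic group, such that the automorphism of `H / Z(H) ≅ ℤ²` induced by
the action of the generator `δ` is conjugate in `GL(2, ℝ)` to a hyperbolic rotation. -/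
def IsDiscreteSplitOscillator (G : Type*) [Group G] : Prop :=
  ∃ (H : Type) (_ : Group H) (φ : Multiplicative ℤ →* MulAut H),
    IsDiscreteHeisenberg H ∧ InducesHyperbolicRotation (φ (Multiplicative.ofAdd 1)) ∧
      Nonempty (G ≃* H ⋊[φ] Multiplicative ℤ)

/-! ### The groups `Osc^r(B, l)` -/

section Osc

variable (r : ℕ) (B : Matrix.SpecialLinearGroup (Fin 2) ℤ) (l : Fin 2 → ℤ)

/-- The images of `α`, `β`, `γ` under the action of `δ`: if `B` has rows `(a, b)` and `(c, d)`,
they are `α ^ a * β ^ c * γ ^ (-l₂)`, `α ^ b * β ^ d * γ ^ l₁` and `γ`. -/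
def oscGen : Fin 3 → Heis r :=
  ![hα r ^ B 0 0 * hβ r ^ B 1 0 * hγ r ^ (-l 1),
    hα r ^ B 0 1 * hβ r ^ B 1 1 * hγ r ^ l 0,
    hγ r]

theorem det_eq : B 0 0 * B 1 1 - B 0 1 * B 1 0 = 1 := by
  rw [← Matrix.det_fin_two]; exact B.det_coe

theorem oscGen_rels : ∀ w ∈ heisRels r, FreeGroup.lift (oscGen r B l) w = 1 := by
  have hd := det_eq B
  apply lift_rels <;> apply (heisEquiv r).injective <;>
    simp only [heisEquiv_apply, oscGen, Matrix.cons_val_zero, Matrix.cons_val_one, Matrix.cons_val, map_mul, map_inv,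
      ← zpow_natCast, map_zpow, toModel_α, toModel_β, toModel_γ, Model.zpow_eq] <;>
    ext <;> simp <;> ring_nf
  linear_combination (r : ℤ) * hd

/-- The endomorphism `φ(δ)` of `H^r(ℤ)`. -/
def oscHom : Heis r →* Heis r := PresentedGroup.toGroup (oscGen_rels r B l)

theorem oscHom_α : oscHom r B l (hα r) = hα r ^ B 0 0 * hβ r ^ B 1 0 * hγ r ^ (-l 1) :=
  PresentedGroup.toGroup.of _
theorem oscHom_β : oscHom r B l (hβ r) = hα r ^ B 0 1 * hβ r ^ B 1 1 * hγ r ^ l 0 :=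
  PresentedGroup.toGroup.of _
theorem oscHom_γ : oscHom r B l (hγ r) = hγ r :=
  PresentedGroup.toGroup.of _

open Model in
theorem toModel_oscHom (x y z : ℤ) :
    toModel r (oscHom r B l (ofModel r ⟨x, y, z⟩)) =
      ⟨B 0 0 * x + B 0 1 * y, B 1 0 * x + B 1 1 * y, z - l 1 * x + l 0 * y -
        r * (B 0 0 * B 1 0 * tri x + B 0 1 * B 1 1 * tri y + B 0 1 * B 1 0 * (x * y))⟩ := by
  change toModel r (oscHom r B l (hα r ^ x * hβ r ^ y * hγ r ^ z)) = _
  simp only [map_mul, map_zpow, oscHom_α, oscHom_β, oscHom_γ, toModel_α, toModel_β, toModel_γ,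
    zpow_eq]
  ext <;> simp <;> ring

theorem oscHom_bijective : Function.Bijective (oscHom r B l) := by
  have hd := det_eq B
  constructor
  · intro g h hgh
    obtain ⟨⟨x, y, z⟩, rfl⟩ := (heisEquiv r).symm.surjective g
    obtain ⟨⟨x', y', z'⟩, rfl⟩ := (heisEquiv r).symm.surjective h
    have := congrArg (toModel r) hgh
    change toModel r (oscHom r B l (ofModel r _)) = toModel r (oscHom r B l (ofModel r _)) at this
    rw [toModel_oscHom, toModel_oscHom, Model.mk.injEq] at this
    obtain ⟨h1, h2, h3⟩ := this
    have hx : x = x' := by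
      linear_combination B 1 1 * h1 - B 0 1 * h2 - (x - x') * hd
    have hy : y = y' := by
      linear_combination B 0 0 * h2 - B 1 0 * h1 - (y - y') * hd
    subst hx hy
    have hz : z = z' := by linarith
    rw [hz]
  · intro g
    obtain ⟨⟨x, y, z⟩, rfl⟩ := (heisEquiv r).symm.surjective g
    set u := B 1 1 * x - B 0 1 * y with hu
    set v := B 0 0 * y - B 1 0 * x with hv
    refine ⟨ofModel r ⟨u, v, z - (0 - l 1 * u + l 0 * v - r * (B 0 0 * B 1 0 * Model.tri u +
      B 0 1 * B 1 1 * Model.tri v + B 0 1 * B 1 0 * (u * v)))⟩, ?_⟩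
    apply (heisEquiv r).injective
    change toModel r _ = toModel r (ofModel r _)
    rw [toModel_oscHom]
    refine Eq.trans ?_ (toModel_normal r x y z).symm
    ext
    · simp only [hu, hv]; linear_combination x * hd
    · simp only [hu, hv]; linear_combination y * hd
    · simp only; ring

/-- The automorphism `φ(δ)` of `H^r(ℤ)` with `φ(δ)(α) = α ^ a * β ^ c * γ ^ (-l₂)`,
`φ(δ)(β) = α ^ b * β ^ d * γ ^ l₁`, `φ(δ)(γ) = γ`. -/
noncomputable def oscAut : MulAut (Heis r) :=
  MulEquiv.ofBijective (oscHom r B l) (oscHom_bijective r B l)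

/-- The group `Osc^r(B, l) = H^r(ℤ) ⋊ ℤδ`, for a representative `l ∈ ℤ²` of a class modulo `r`. -/
abbrev Osc : Type := Heis r ⋊[zpowersHom (MulAut (Heis r)) (oscAut r B l)] Multiplicative ℤ

end Osc

/-! ### Commensurability -/

/-- Two groups are abstractly commensurable if they have isomorphic subgroups of finite index. -/
def AbstractlyCommensurable (G₁ G₂ : Type*) [Group G₁] [Group G₂] : Prop :=
  ∃ (H₁ : Subgroup G₁) (H₂ : Subgroup G₂),
    H₁.FiniteIndex ∧ H₂.FiniteIndex ∧ Nonempty (H₁ ≃* H₂)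

theorem AbstractlyCommensurable.refl (G : Type*) [Group G] : AbstractlyCommensurable G G :=
  ⟨⊤, ⊤, inferInstance, inferInstance, ⟨MulEquiv.refl _⟩⟩

theorem AbstractlyCommensurable.symm {G₁ G₂ : Type*} [Group G₁] [Group G₂]
    (h : AbstractlyCommensurable G₁ G₂) : AbstractlyCommensurable G₂ G₁ := by
  obtain ⟨H₁, H₂, h₁, h₂, ⟨e⟩⟩ := h
  exact ⟨H₂, H₁, h₂, h₁, ⟨e.symm⟩⟩

/-- If `e : H₂ ≃* H₁` with `H₁ ≤ G₁` of finite index and `K ≤ G₂` has finite index, then the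
image of `K ∩ H₂` under `e` has finite index in `G₁`. -/
theorem finiteIndex_image {G₁ G₂ : Type*} [Group G₁] [Group G₂] {H₁ : Subgroup G₁}
    {H₂ : Subgroup G₂} (h₁ : H₁.FiniteIndex) (e : H₂ ≃* H₁) (K : Subgroup G₂)
    (hK : K.FiniteIndex) :
    (((K.subgroupOf H₂).map e.toMonoidHom).map H₁.subtype).FiniteIndex := by
  constructor
  rw [Subgroup.index_map_subtype]
  refine mul_ne_zero ?_ h₁.index_ne_zero
  have : (K.subgroupOf H₂).FiniteIndex := inferInstance
  rw [show (K.subgroupOf H₂).map e.toMonoidHom = (K.subgroupOf H₂).map (e : H₂ →* H₁) from rfl,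
    Subgroup.index_map_equiv]
  exact this.index_ne_zero

theorem AbstractlyCommensurable.trans {G₁ G₂ G₃ : Type*} [Group G₁] [Group G₂] [Group G₃]
    (h : AbstractlyCommensurable G₁ G₂) (h' : AbstractlyCommensurable G₂ G₃) :
    AbstractlyCommensurable G₁ G₃ := by
  obtain ⟨H₁, H₂, h₁, h₂, ⟨e⟩⟩ := h
  obtain ⟨K₂, K₃, k₂, k₃, ⟨f⟩⟩ := h'
  refine ⟨_, _, finiteIndex_image h₁ e.symm K₂ k₂, finiteIndex_image k₃ f H₂ h₂, ⟨?_⟩⟩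
  have hm : (K₂.subgroupOf H₂).map H₂.subtype = (H₂.subgroupOf K₂).map K₂.subtype := by
    rw [Subgroup.subgroupOf_map_subtype, Subgroup.subgroupOf_map_subtype, inf_comm]
  exact (((K₂.subgroupOf H₂).equivMapOfInjective e.symm.toMonoidHom e.symm.injective).trans
      (Subgroup.equivMapOfInjective _ _ H₁.subtype_injective)).symm.trans <|
    (Subgroup.equivMapOfInjective _ _ H₂.subtype_injective).trans <|
    (MulEquiv.subgroupCongr hm).trans <|
    (Subgroup.equivMapOfInjective _ _ K₂.subtype_injective).symm.trans <|
    ((H₂.subgroupOf K₂).equivMapOfInjective f.toMonoidHom f.injective).trans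
      (Subgroup.equivMapOfInjective _ _ K₃.subtype_injective)

/-- The discrete split oscillator groups. -/
structure SplitOscGroup : Type 1 where
  carrier : Type
  [group : Group carrier]
  isDiscreteSplitOscillator : IsDiscreteSplitOscillator carrier

attribute [instance] SplitOscGroup.group

/-- Abstract commensurability as an equivalence relation on the discrete split oscillator
groups. -/
instance commSetoid : Setoid SplitOscGroup where
  r G₁ G₂ := AbstractlyCommensurable G₁.carrier G₂.carrier
  iseqv := ⟨fun G => .refl G.carrier, fun h => h.symm, fun h h' => h.trans h'⟩

/-- The abstract commensurability classes of discrete split oscillator groups. -/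
abbrev CommClass : Type 1 := Quotient commSetoid

/-- The real quadratic fields, as subfields of `ℝ` of degree two over `ℚ`. -/
abbrev RealQuadraticField : Type := {K : IntermediateField ℚ ℝ // Module.finrank ℚ K = 2}

/-- The real number `lam` is an eigenvalue of the integer matrix `B`. -/
def IsEigenvalue (B : Matrix.SpecialLinearGroup (Fin 2) ℤ) (lam : ℝ) : Prop :=
  Module.End.HasEigenvalue
    (Matrix.toLin' ((B : Matrix (Fin 2) (Fin 2) ℤ).map (Int.cast : ℤ → ℝ))) lam

/-- `B` as an element of `GL(2, ℚ)`. -/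
def toGLRat (B : Matrix.SpecialLinearGroup (Fin 2) ℤ) : GL (Fin 2) ℚ :=
  Matrix.SpecialLinearGroup.toGL (Matrix.SpecialLinearGroup.map (Int.castRingHom ℚ) B)

/-- `B₁ ∼ B₂`: some nonzero powers of `B₁` and `B₂` are conjugate over `ℚ`. -/
def PowersConj (B₁ B₂ : Matrix.SpecialLinearGroup (Fin 2) ℤ) : Prop :=
  ∃ m n : ℤ, m ≠ 0 ∧ n ≠ 0 ∧ ∃ M : GL (Fin 2) ℚ,
    toGLRat B₁ ^ m = M * toGLRat B₂ ^ n * M⁻¹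

end SplitOsc

namespace SplitOsc

open Matrix

/-! ### The projection of `H^r(ℤ)` onto `ℤ²` -/

/-! Modulo ⟨γ⟩ the group `Heis r` is ℤ², and its commutators are r times the determinant pairing.
For r > 0, an automorphism inducing B ∈ SL(2, ℤ) on ℤ² therefore fixes γ and is given by B and two
central exponents, so it is an `oscAut` (`exists_eq_oscAut`). Being conjugate to a hyperbolic
rotation means determinant 1 and trace 2 cosh s > 2, which classifies the groups.

An isomorphism f of finite-index subgroups need not respect the projection to ℤ², but it respects
commutators and centralizers. Applied to a commutator v, the characteristic polynomial of A = B₁ ^ m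
becomes a word with central value; its image under f forces a power of B₂ to have the trace of A
(`exists_trace_eq_of_commensurable`). Nonzero powers are non-scalar, so equal traces amount to
conjugacy over ℚ (`powersConj_iff`). Conversely, a conjugacy over ℚ gives an integral intertwining
matrix, a multiple of which lifts to an equivariant embedding of Heisenberg groups of finite index
(`exists_heisHom_intertwining`); passing to powers of B only passes to subgroups of finite index.

With t = tr B, the field of B is ℚ(√(t² - 4)). Powers of B commute with B, so they have the same
field, and equal traces of powers give equal fields. If the fields agree, then suitable powers of B₁
and B₂ have traces 2x with x² - Dy² = 1 for one common D. Solutions of this Pell equation are, up to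
sign, powers of a fundamental one, so further powers have equal traces
(`exists_trace_eq_of_sqrtField_eq`). Pell solutions also produce a matrix for every real quadratic
field. -/

/-- The coordinates in `ℤ²` of the class of `h` modulo the center. -/
def vec {r : ℕ} (h : Heis r) : Fin 2 → ℤ := ![(toModel r h).x, (toModel r h).y]

section vec

variable {r : ℕ}

@[simp] theorem vec_zero (h : Heis r) : vec h 0 = (toModel r h).x := rfl
@[simp] theorem vec_one' (h : Heis r) : vec h 1 = (toModel r h).y := rfl

@[simp] theorem vec_mul (g h : Heis r) : vec (g * h) = vec g + vec h := by
  ext i; fin_cases i <;> simp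

@[simp] theorem vec_one : vec (1 : Heis r) = 0 := by
  ext i; fin_cases i <;> simp

@[simp] theorem vec_inv (g : Heis r) : vec g⁻¹ = -vec g := by
  ext i; fin_cases i <;> simp

@[simp] theorem vec_zpow (g : Heis r) (n : ℤ) : vec (g ^ n) = n • vec g := by
  ext i; fin_cases i <;> simp [Model.zpow_eq]

@[simp] theorem vec_α : vec (hα r) = ![1, 0] := by simp [vec, toModel_α]
@[simp] theorem vec_β : vec (hβ r) = ![0, 1] := by simp [vec, toModel_β]
@[simp] theorem vec_γ : vec (hγ r) = 0 := by simp [vec, toModel_γ]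

theorem eq_normal (h : Heis r) : h = hα r ^ (toModel r h).x * hβ r ^ (toModel r h).y *
    hγ r ^ (toModel r h).z :=
  (ofModel_toModel r h).symm

theorem eq_zpow_of_vec_eq_zero {h : Heis r} (hh : vec h = 0) :
    h = hγ r ^ (toModel r h).z := by
  have h0 : (toModel r h).x = 0 := congrFun hh 0
  have h1 : (toModel r h).y = 0 := congrFun hh 1
  conv_lhs => rw [eq_normal h, h0, h1]
  simp

theorem commute_γ (h : Heis r) : h * hγ r = hγ r * h := by
  apply (heisEquiv r).injective
  simp only [map_mul, heisEquiv_apply, toModel_γ]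
  ext <;> simp [add_comm]

theorem commute_of_vec_eq_zero {g : Heis r} (hg : vec g = 0) (h : Heis r) : Commute h g := by
  rw [eq_zpow_of_vec_eq_zero hg]
  exact Commute.zpow_right (commute_γ h) _

/-- The determinant pairing controls both the center (it is nondegenerate for r > 0) and the action
of an automorphism on γ (through the determinant of the induced matrix). -/
theorem commutator_eq (g h : Heis r) :
    g * h * g⁻¹ * h⁻¹ = hγ r ^ (r * (vec g 0 * vec h 1 - vec g 1 * vec h 0)) := by
  apply (heisEquiv r).injective
  simp only [map_mul, map_inv, map_zpow, heisEquiv_apply, toModel_γ, Model.zpow_eq]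
  ext <;> simp
  ring

theorem zpow_γ_injective : Function.Injective fun n : ℤ => hγ r ^ n := by
  intro m n h
  simpa [toModel_γ, Model.zpow_eq] using congrArg (toModel r) h

theorem mem_center_iff (hr : 0 < r) (h : Heis r) :
    h ∈ Subgroup.center (Heis r) ↔ vec h = 0 := by
  refine ⟨fun hh => ?_, fun hh => Subgroup.mem_center_iff.2 fun g => commute_of_vec_eq_zero hh g⟩
  have key : ∀ g : Heis r, vec g 0 * vec h 1 - vec g 1 * vec h 0 = 0 := by
    intro g
    have h1 := commutator_eq g h
    rw [Subgroup.mem_center_iff.1 hh g] at h1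
    have h2 : hγ r ^ (0 : ℤ) = hγ r ^ (r * (vec g 0 * vec h 1 - vec g 1 * vec h 0)) := by
      rw [← h1]; group
    have h3 := zpow_γ_injective h2
    simpa [hr.ne'] using h3.symm
  have h1 := key (hα r)
  have h2 := key (hβ r)
  simp only [vec_α, vec_β, cons_val_zero, cons_val_one] at h1 h2
  ext i
  fin_cases i
  · simp only [Fin.zero_eta, Pi.zero_apply]; linarith
  · simp only [Fin.mk_one, Pi.zero_apply]; linarith

/-- The projection `H^r(ℤ) → ℤ²` as a homomorphism. -/
def vecHom (r : ℕ) : Heis r →* Multiplicative (Fin 2 → ℤ) :=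
  MonoidHom.mk' (fun h => Multiplicative.ofAdd (vec h)) (by intro g h; simp)

theorem vecHom_surjective : Function.Surjective (vecHom r) := by
  intro v
  refine ⟨hα r ^ v.toAdd 0 * hβ r ^ v.toAdd 1, ?_⟩
  change Multiplicative.ofAdd (vec _) = _
  apply Multiplicative.toAdd.injective
  ext i
  fin_cases i <;> simp

theorem ker_vecHom (hr : 0 < r) : (vecHom r).ker = Subgroup.center (Heis r) := by
  ext h
  rw [mem_center_iff hr]
  rfl

theorem vec_oscHom (B : SpecialLinearGroup (Fin 2) ℤ) (l : Fin 2 → ℤ) (h : Heis r) :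
    vec (oscHom r B l h) = (B : Matrix (Fin 2) (Fin 2) ℤ) *ᵥ vec h := by
  have := toModel_oscHom r B l (toModel r h).x (toModel r h).y (toModel r h).z
  rw [show (⟨(toModel r h).x, (toModel r h).y, (toModel r h).z⟩ : Model r) = toModel r h from rfl,
    ofModel_toModel] at this
  ext i
  fin_cases i <;> simp [this, mulVec, dotProduct, Fin.sum_univ_two]

theorem vec_oscAut (B : SpecialLinearGroup (Fin 2) ℤ) (l : Fin 2 → ℤ) (h : Heis r) :
    vec (oscAut r B l h) = (B : Matrix (Fin 2) (Fin 2) ℤ) *ᵥ vec h :=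
  vec_oscHom B l h

theorem vec_aut_inv {f : MulAut (Heis r)} {B : SpecialLinearGroup (Fin 2) ℤ}
    (hf : ∀ h, vec (f h) = (B : Matrix (Fin 2) (Fin 2) ℤ) *ᵥ vec h) (h : Heis r) :
    vec (f⁻¹ h) = ((B⁻¹ : SpecialLinearGroup (Fin 2) ℤ) : Matrix (Fin 2) (Fin 2) ℤ) *ᵥ vec h := by
  have h1 := hf (f⁻¹ h)
  rw [MulAut.apply_inv_self] at h1
  have h2 : ((B⁻¹ : SpecialLinearGroup (Fin 2) ℤ) : Matrix (Fin 2) (Fin 2) ℤ) * B = 1 := by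
    rw [← Matrix.SpecialLinearGroup.coe_mul, inv_mul_cancel, Matrix.SpecialLinearGroup.coe_one]
  rw [h1, mulVec_mulVec, h2, one_mulVec]

theorem vec_aut_zpow {f : MulAut (Heis r)} {B : SpecialLinearGroup (Fin 2) ℤ}
    (hf : ∀ h, vec (f h) = (B : Matrix (Fin 2) (Fin 2) ℤ) *ᵥ vec h) (n : ℤ) (h : Heis r) :
    vec ((f ^ n) h) = ((B ^ n : SpecialLinearGroup (Fin 2) ℤ) : Matrix (Fin 2) (Fin 2) ℤ) *ᵥ
      vec h := by
  induction n using Int.induction_on with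
  | zero => simp
  | succ n ih =>
    rw [add_comm, _root_.zpow_add, zpow_one, MulAut.mul_apply, hf, ih, mulVec_mulVec,
      _root_.zpow_add, zpow_one,
      Matrix.SpecialLinearGroup.coe_mul]
  | pred n ih =>
    rw [sub_eq_add_neg, add_comm, _root_.zpow_add, _root_.zpow_neg_one, MulAut.mul_apply,
      vec_aut_inv hf, ih,
      mulVec_mulVec, _root_.zpow_add, _root_.zpow_neg_one, Matrix.SpecialLinearGroup.coe_mul]

theorem hom_ext_heis {G : Type*} [Group G] {f g : Heis r →* G} (h0 : f (hα r) = g (hα r))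
    (h1 : f (hβ r) = g (hβ r)) (h2 : f (hγ r) = g (hγ r)) : f = g := by
  apply PresentedGroup.ext
  intro i
  fin_cases i
  exacts [h0, h1, h2]

/-- An automorphism of `H^r(ℤ)` that induces `B ∈ SL(2, ℤ)` on `ℤ²` is one of the automorphisms
defining the groups `Osc^r(B, l)`. -/
theorem exists_eq_oscAut (hr : 0 < r) {f : MulAut (Heis r)} {B : SpecialLinearGroup (Fin 2) ℤ}
    (hf : ∀ h, vec (f h) = (B : Matrix (Fin 2) (Fin 2) ℤ) *ᵥ vec h) :
    ∃ l, f = oscAut r B l := by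
  have hd := det_eq B
  have hγ' : f (hγ r) = hγ r := by
    have h0 : vec (f (hγ r)) = 0 := by rw [hf, vec_γ, mulVec_zero]
    have h1 := eq_zpow_of_vec_eq_zero h0
    set k := (toModel r (f (hγ r))).z
    -- With f γ = γ ^ k, the defining relation maps to γ ^ (r det B) = γ ^ (k r), so k = det B = 1.
    have h2 := congrArg f (rel_ab r)
    simp only [map_mul, map_inv, map_pow] at h2
    rw [commutator_eq, h1, hf, hf, ← zpow_natCast, ← _root_.zpow_mul] at h2
    have h3 := zpow_γ_injective h2
    simp [mulVec, dotProduct, Fin.sum_univ_two] at h3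
    have h4 : (r : ℤ) * k = r * 1 := by
      rw [mul_comm, ← h3]
      congr 1
      linarith
    rw [h1, mul_left_cancel₀ (by positivity) h4, zpow_one]
  -- The swap and the sign match `oscGen`, where α carries γ ^ (-l₂) and β carries γ ^ l₁.
  refine ⟨![(toModel r (f (hβ r))).z, -(toModel r (f (hα r))).z], ?_⟩
  have hx := fun h => congrFun (hf h) 0
  have hy := fun h => congrFun (hf h) 1
  simp only [vec_zero, vec_one', mulVec, dotProduct, Fin.sum_univ_two] at hx hy
  have key : f.toMonoidHom = oscHom r B ![(toModel r (f (hβ r))).z, -(toModel r (f (hα r))).z] := by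
    apply hom_ext_heis
    · rw [oscHom_α]
      refine (eq_normal _).trans ?_
      simp [hx, hy, toModel_α]
    · rw [oscHom_β]
      refine (eq_normal _).trans ?_
      simp [hx, hy, toModel_β]
    · rw [oscHom_γ]
      exact hγ'
  ext h
  exact DFunLike.congr_fun key h

end vec

/-! ### Hyperbolic rotations -/

theorem IsConjHyperbolicRotation.det_trace {B : Matrix (Fin 2) (Fin 2) ℤ}
    (hB : IsConjHyperbolicRotation B) : B.det = 1 ∧ 2 < B.trace := by
  obtain ⟨s, hs, P, hP⟩ := hB
  have hdet : (B.map (Int.cast : ℤ → ℝ)).det = 1 := by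
    rw [hP, det_mul, det_mul, det_fin_two_of, mul_right_comm, ← det_mul, ← Units.val_mul,
      mul_inv_cancel]
    simp only [Units.val_one, det_one, one_mul]
    linarith [Real.cosh_sq s]
  have htr : (B.map (Int.cast : ℤ → ℝ)).trace = 2 * Real.cosh s := by
    rw [hP, trace_mul_comm, ← mul_assoc, ← Units.val_mul, inv_mul_cancel]
    simp [trace_fin_two]
    ring
  constructor
  · have : ((B.det : ℤ) : ℝ) = 1 := by rw [← hdet, det_fin_two, det_fin_two]; simp
    exact_mod_cast this
  · have h1 : ((B.trace : ℤ) : ℝ) = 2 * Real.cosh s := by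
      rw [← htr, trace_fin_two, trace_fin_two]; simp
    have h2 := Real.one_lt_cosh.2 hs
    have : (2 : ℝ) < ((B.trace : ℤ) : ℝ) := by linarith
    exact_mod_cast this

/-- A triangular matrix in SL(2, ℤ) has diagonal entries ±1, hence trace ±2. The conclusion makes e₁
a cyclic vector for B. -/
theorem lower_left_ne_zero {B : SpecialLinearGroup (Fin 2) ℤ}
    (hB : 2 < (B : Matrix (Fin 2) (Fin 2) ℤ).trace) : B 1 0 ≠ 0 := by
  intro h
  have hd := det_eq B
  rw [trace_fin_two] at hB
  rw [h, mul_zero, sub_zero] at hd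
  rcases Int.eq_one_or_neg_one_of_mul_eq_one' hd with ⟨h1, h2⟩ | ⟨h1, h2⟩ <;> omega

theorem isConjHyperbolicRotation {B : SpecialLinearGroup (Fin 2) ℤ}
    (hB : 2 < (B : Matrix (Fin 2) (Fin 2) ℤ).trace) :
    IsConjHyperbolicRotation (B : Matrix (Fin 2) (Fin 2) ℤ) := by
  have hc := lower_left_ne_zero hB
  have hd := det_eq B
  rw [trace_fin_two] at hB
  have ht : (1 : ℝ) < ((B 0 0 + B 1 1 : ℤ) : ℝ) / 2 := by
    have : (2 : ℝ) < ((B 0 0 + B 1 1 : ℤ) : ℝ) := by exact_mod_cast hB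
    linarith
  set s := Real.arcosh (((B 0 0 + B 1 1 : ℤ) : ℝ) / 2) with hs
  have hC : Real.cosh s = ((B 0 0 + B 1 1 : ℤ) : ℝ) / 2 := Real.cosh_arcosh ht.le
  have hs0 : s ≠ 0 := by
    intro h0
    rw [h0, Real.cosh_zero] at hC
    linarith
  have hS : Real.sinh s ≠ 0 := by simpa using hs0
  have hcR : ((B 1 0 : ℤ) : ℝ) ≠ 0 := by exact_mod_cast hc
  have hdR : ((B 0 0 : ℤ) : ℝ) * (B 1 1 : ℤ) - (B 0 1 : ℤ) * (B 1 0 : ℤ) = 1 := by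
    exact_mod_cast hd
  have hsq := Real.cosh_sq s
  set C := Real.cosh s
  set S := Real.sinh s
  -- The first column is sinh s · e₁; the first column of BP = P·(rotation) then forces the second
  -- to be (B - cosh s) e₁. The other column holds by Cayley–Hamilton, as tr B = 2 cosh s.
  let P : Matrix (Fin 2) (Fin 2) ℝ := !![S, (B 0 0 : ℤ) - C; 0, (B 1 0 : ℤ)]
  have hP : P.det ≠ 0 := by
    simp only [P, det_fin_two_of, mul_zero, sub_zero]
    exact mul_ne_zero hS hcR
  refine ⟨s, hs0, GeneralLinearGroup.mkOfDetNeZero P hP, ?_⟩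
  have key : (B : Matrix (Fin 2) (Fin 2) ℤ).map (Int.cast : ℤ → ℝ) *
      (GeneralLinearGroup.mkOfDetNeZero P hP : Matrix (Fin 2) (Fin 2) ℝ) =
      (GeneralLinearGroup.mkOfDetNeZero P hP : Matrix (Fin 2) (Fin 2) ℝ) * !![C, S; S, C] := by
    change _ * P = P * _
    push_cast at hC
    ext i j
    fin_cases i <;> fin_cases j <;> simp [P, mul_apply, Fin.sum_univ_two]
    · ring
    · linear_combination hsq - hdR - 2 * ((B 0 0 : ℤ) : ℝ) * hC
    · linear_combination (-2 * ((B 1 0 : ℤ) : ℝ)) * hC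
  rw [← key, mul_assoc, ← Units.val_mul, mul_inv_cancel, Units.val_one, mul_one]

/-! ### Discrete split oscillator groups are the groups `Osc^r(B, l)` -/

theorem isDiscreteSplitOscillator_osc {r : ℕ} (hr : 0 < r) {B : SpecialLinearGroup (Fin 2) ℤ}
    (l : Fin 2 → ℤ) (hB : 2 < (B : Matrix (Fin 2) (Fin 2) ℤ).trace) {G : Type*} [Group G]
    (e : G ≃* Osc r B l) : IsDiscreteSplitOscillator G := by
  refine ⟨Heis r, inferInstance, _, ⟨r, hr, ⟨MulEquiv.refl _⟩⟩, ?_, ⟨e⟩⟩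
  refine ⟨(QuotientGroup.quotientMulEquivOfEq (ker_vecHom hr).symm).trans
    (QuotientGroup.quotientKerEquivOfSurjective _ vecHom_surjective), B, fun h => ?_,
    isConjHyperbolicRotation hB⟩
  rw [zpowersHom_apply, toAdd_ofAdd, zpow_one]
  exact vec_oscAut B l h

theorem toAdd_hom_apply {r : ℕ} (u : Heis r →* Multiplicative (Fin 2 → ℤ))
    (hu : (u (hγ r)).toAdd = 0) (h : Heis r) :
    (u h).toAdd = (Matrix.of ![(u (hα r)).toAdd, (u (hβ r)).toAdd])ᵀ *ᵥ vec h := by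
  conv_lhs => rw [eq_normal h]
  simp only [map_mul, map_zpow, toAdd_mul, toAdd_zpow, hu]
  ext i
  simp [mulVec, dotProduct, Fin.sum_univ_two, mul_comm]

theorem exists_equiv_osc {G : Type*} [Group G] (hG : IsDiscreteSplitOscillator G) :
    ∃ (r : ℕ) (B : SpecialLinearGroup (Fin 2) ℤ) (l : Fin 2 → ℤ),
      0 < r ∧ 2 < (B : Matrix (Fin 2) (Fin 2) ℤ).trace ∧ Nonempty (G ≃* Osc r B l) := by
  obtain ⟨H, _, φ, ⟨r, hr, ⟨ψ⟩⟩, ⟨e, A, hA, hrot⟩, ⟨i⟩⟩ := hG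
  obtain ⟨hdet, htr⟩ := hrot.det_trace
  set f : MulAut (Heis r) := MulAut.congr ψ (φ (Multiplicative.ofAdd 1)) with hf
  let u : Heis r →* Multiplicative (Fin 2 → ℤ) :=
    e.toMonoidHom.comp ((QuotientGroup.mk' _).comp ψ.symm.toMonoidHom)
  have hu : Function.Surjective u :=
    e.surjective.comp ((QuotientGroup.mk'_surjective _).comp ψ.symm.surjective)
  have huγ : (u (hγ r)).toAdd = 0 := by
    have : (QuotientGroup.mk (ψ.symm (hγ r)) : H ⧸ Subgroup.center H) = 1 := by
      rw [QuotientGroup.eq_one_iff, Subgroup.mem_center_iff]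
      intro g
      apply ψ.injective
      simp only [map_mul, MulEquiv.apply_symm_apply]
      exact commute_γ _
    change (e (QuotientGroup.mk (ψ.symm (hγ r)))).toAdd = 0
    rw [this, map_one, toAdd_one]
  have huf : ∀ h, (u (f h)).toAdd = A *ᵥ (u h).toAdd := by
    intro h
    rw [← show _ = A *ᵥ (u h).toAdd from hA (ψ.symm h)]
    change (e (QuotientGroup.mk (ψ.symm (ψ (φ _ (ψ.symm h)))))).toAdd = _
    rw [MulEquiv.symm_apply_apply]
  set P := (Matrix.of ![(u (hα r)).toAdd, (u (hβ r)).toAdd])ᵀ with hP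
  have huP : ∀ h, (u h).toAdd = P *ᵥ vec h := toAdd_hom_apply u huγ
  -- A surjective endomorphism of ℤ² is invertible, so P is a change of basis from the coordinates
  -- `vec` to those of the given isomorphism `e`.
  have hPsurj : Function.Surjective P.mulVec := by
    intro w
    obtain ⟨h, hh⟩ := hu (Multiplicative.ofAdd w)
    exact ⟨vec h, by rw [← huP, hh, toAdd_ofAdd]⟩
  obtain ⟨Q, hPQ⟩ := mulVec_surjective_iff_exists_right_inverse.1 hPsurj
  have hQP : Q * P = 1 := mul_eq_one_comm.1 hPQ
  let B : SpecialLinearGroup (Fin 2) ℤ := ⟨Q * A * P, by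
    rw [det_mul, det_mul, hdet, mul_one, ← det_mul, hQP, det_one]⟩
  have hB : ∀ h, vec (f h) = (B : Matrix (Fin 2) (Fin 2) ℤ) *ᵥ vec h := by
    intro h
    change _ = (Q * A * P) *ᵥ vec h
    rw [← mulVec_mulVec, ← huP, ← mulVec_mulVec, ← huf, huP, mulVec_mulVec, hQP, one_mulVec]
  obtain ⟨l, hl⟩ := exists_eq_oscAut hr hB
  refine ⟨r, B, l, hr, ?_, ⟨i.trans ?_⟩⟩
  · change 2 < (Q * A * P).trace
    rwa [trace_mul_comm, ← mul_assoc, hPQ, one_mul]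
  · refine SemidirectProduct.congr ψ (MulEquiv.refl _) fun n => ?_
    have hφ : φ n = φ (Multiplicative.ofAdd 1) ^ n.toAdd := by
      rw [← map_zpow, ← ofAdd_zsmul]; simp
    rw [hφ]
    ext h
    have h1 : (MulAut.congr ψ) (φ (Multiplicative.ofAdd 1) ^ n.toAdd) = f ^ n.toAdd := by
      rw [map_zpow]
    have h2 := DFunLike.congr_fun h1 (ψ h)
    simp only [MulAut.congr_apply, MulEquiv.trans_apply, MulEquiv.symm_apply_apply] at h2
    simpa [← hl] using h2

/-! ### Traces of powers -/

/-- Cayley–Hamilton, A² = (tr A) A - 1, in the form in which it is later read off a word in the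
group. -/
theorem mulVec_mulVec_eq (A : SpecialLinearGroup (Fin 2) ℤ) (w : Fin 2 → ℤ) :
    (A : Matrix (Fin 2) (Fin 2) ℤ) *ᵥ ((A : Matrix (Fin 2) (Fin 2) ℤ) *ᵥ w) =
      (A : Matrix (Fin 2) (Fin 2) ℤ).trace • ((A : Matrix (Fin 2) (Fin 2) ℤ) *ᵥ w) - w := by
  have hd := det_eq A
  ext i
  fin_cases i
  · simp [mulVec, dotProduct, Fin.sum_univ_two, trace_fin_two]
    linear_combination (-w 0) * hd
  · simp [mulVec, dotProduct, Fin.sum_univ_two, trace_fin_two]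
    linear_combination (-w 1) * hd

theorem eq_zero_of_mulVec_eq_zero {A : SpecialLinearGroup (Fin 2) ℤ} {w : Fin 2 → ℤ}
    (h : (A : Matrix (Fin 2) (Fin 2) ℤ) *ᵥ w = 0) : w = 0 := by
  have := mulVec_mulVec_eq A w
  rw [h, mulVec_zero, smul_zero, zero_sub] at this
  exact neg_eq_zero.1 this.symm

theorem eq_zero_of_mulVec_eq_self {A : SpecialLinearGroup (Fin 2) ℤ}
    (hA : (A : Matrix (Fin 2) (Fin 2) ℤ).trace ≠ 2) {w : Fin 2 → ℤ}
    (h : (A : Matrix (Fin 2) (Fin 2) ℤ) *ᵥ w = w) : w = 0 := by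
  have := mulVec_mulVec_eq A w
  rw [h, h] at this
  have h2 : ((A : Matrix (Fin 2) (Fin 2) ℤ).trace - 2) • w = 0 := by
    rw [sub_smul, two_smul, ← sub_sub, ← this, sub_self]
  exact (smul_eq_zero.1 h2).resolve_left (sub_ne_zero.2 hA)

theorem trace_inv (B : SpecialLinearGroup (Fin 2) ℤ) :
    ((B⁻¹ : SpecialLinearGroup (Fin 2) ℤ) : Matrix (Fin 2) (Fin 2) ℤ).trace =
      (B : Matrix (Fin 2) (Fin 2) ℤ).trace := by
  rw [Matrix.SpecialLinearGroup.coe_inv, adjugate_fin_two, trace_fin_two_of, trace_fin_two,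
    add_comm]

theorem trace_pow_add_two (B : SpecialLinearGroup (Fin 2) ℤ) (n : ℕ) :
    ((B ^ (n + 2) : SpecialLinearGroup (Fin 2) ℤ) : Matrix (Fin 2) (Fin 2) ℤ).trace =
      (B : Matrix (Fin 2) (Fin 2) ℤ).trace *
        ((B ^ (n + 1) : SpecialLinearGroup (Fin 2) ℤ) : Matrix (Fin 2) (Fin 2) ℤ).trace -
      ((B ^ n : SpecialLinearGroup (Fin 2) ℤ) : Matrix (Fin 2) (Fin 2) ℤ).trace := by
  have hd := det_eq B
  rw [pow_succ, pow_succ]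
  simp only [trace_fin_two, Matrix.SpecialLinearGroup.coe_mul, mul_apply, Fin.sum_univ_two]
  set X := B ^ n
  linear_combination (-(X 0 0) - X 1 1) * hd

/-- The traces satisfy x_{n+2} = t x_{n+1} - x_n with t > 2; the induction carries the strict
increase along with the lower bound. -/
theorem two_lt_trace_pow {B : SpecialLinearGroup (Fin 2) ℤ}
    (hB : 2 < (B : Matrix (Fin 2) (Fin 2) ℤ).trace) (n : ℕ) :
    2 ≤ ((B ^ n : SpecialLinearGroup (Fin 2) ℤ) : Matrix (Fin 2) (Fin 2) ℤ).trace ∧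
      ((B ^ n : SpecialLinearGroup (Fin 2) ℤ) : Matrix (Fin 2) (Fin 2) ℤ).trace <
      ((B ^ (n + 1) : SpecialLinearGroup (Fin 2) ℤ) : Matrix (Fin 2) (Fin 2) ℤ).trace := by
  induction n with
  | zero =>
    simp only [zero_add, pow_one, pow_zero, Matrix.SpecialLinearGroup.coe_one]
    constructor
    · simp
    · simpa using hB
  | succ n ih =>
    rw [trace_pow_add_two]
    exact ⟨by linarith, by nlinarith⟩

theorem two_lt_trace_zpow {B : SpecialLinearGroup (Fin 2) ℤ}
    (hB : 2 < (B : Matrix (Fin 2) (Fin 2) ℤ).trace) {m : ℤ} (hm : m ≠ 0) :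
    2 < ((B ^ m : SpecialLinearGroup (Fin 2) ℤ) : Matrix (Fin 2) (Fin 2) ℤ).trace := by
  have key : ∀ n : ℕ, n ≠ 0 →
      2 < ((B ^ n : SpecialLinearGroup (Fin 2) ℤ) : Matrix (Fin 2) (Fin 2) ℤ).trace := by
    intro n hn
    obtain ⟨k, rfl⟩ := Nat.exists_eq_succ_of_ne_zero hn
    have := two_lt_trace_pow hB k
    exact this.1.trans_lt this.2
  obtain ⟨n, rfl | rfl⟩ := m.eq_nat_or_neg
  · rw [zpow_natCast]
    exact key n (by simpa using hm)
  · rw [_root_.zpow_neg, zpow_natCast, trace_inv]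
    exact key n (by simpa using hm)

/-- Commuting 2 × 2 matrices have proportional trace-free parts, compared here through their
lower-left entries. Since (2B - tr B)² = (tr B)² - 4 in determinant 1, the discriminants scale by
the square of that ratio. -/
theorem disc_mul_sq_eq_of_commute {X B : SpecialLinearGroup (Fin 2) ℤ} (h : Commute X B) :
    ((X : Matrix (Fin 2) (Fin 2) ℤ).trace ^ 2 - 4) * B 1 0 ^ 2 =
      ((B : Matrix (Fin 2) (Fin 2) ℤ).trace ^ 2 - 4) * X 1 0 ^ 2 := by
  have hB := det_eq B
  have hX := det_eq X
  have h' : (X : Matrix (Fin 2) (Fin 2) ℤ) * B = B * X := by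
    rw [← Matrix.SpecialLinearGroup.coe_mul, h.eq, Matrix.SpecialLinearGroup.coe_mul]
  have h0 := congrFun (congrFun h' 0) 0
  have h1 := congrFun (congrFun h' 1) 0
  simp only [mul_apply, Fin.sum_univ_two] at h0 h1
  have h2 : (X 0 0 - X 1 1) * B 1 0 = (B 0 0 - B 1 1) * X 1 0 := by linarith
  have h3 : X 0 1 * B 1 0 = B 0 1 * X 1 0 := by linarith
  rw [trace_fin_two, trace_fin_two]
  linear_combination ((X 0 0 - X 1 1) * B 1 0 + (B 0 0 - B 1 1) * X 1 0) * h2 +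
    4 * X 1 0 * B 1 0 * h3 - 4 * X 1 0 ^ 2 * hB + 4 * B 1 0 ^ 2 * hX

/-! ### Conjugacy over `ℚ` -/

theorem toGLRat_zpow (B : SpecialLinearGroup (Fin 2) ℤ) (m : ℤ) :
    toGLRat (B ^ m) = toGLRat B ^ m :=
  map_zpow ((Matrix.SpecialLinearGroup.toGL).comp
    (Matrix.SpecialLinearGroup.map (n := Fin 2) (Int.castRingHom ℚ))) B m

theorem coe_toGLRat (B : SpecialLinearGroup (Fin 2) ℤ) :
    (toGLRat B : Matrix (Fin 2) (Fin 2) ℚ) =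
      (B : Matrix (Fin 2) (Fin 2) ℤ).map (Int.cast : ℤ → ℚ) :=
  rfl

/-- A non-scalar matrix of determinant `1` is conjugate to the companion matrix of its
characteristic polynomial. -/
theorem exists_conj_companion {B : SpecialLinearGroup (Fin 2) ℤ} (hB : B 1 0 ≠ 0) :
    ∃ P : GL (Fin 2) ℚ, ((P⁻¹ * toGLRat B * P : GL (Fin 2) ℚ) : Matrix (Fin 2) (Fin 2) ℚ) =
      !![0, -1; 1, ((B : Matrix (Fin 2) (Fin 2) ℤ).trace : ℚ)] := by
  have hd : ((B 0 0 : ℤ) : ℚ) * (B 1 1 : ℤ) - (B 0 1 : ℤ) * (B 1 0 : ℤ) = 1 := by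
    exact_mod_cast det_eq B
  -- The columns are e₁ and B e₁, the cyclic basis.
  let P : GL (Fin 2) ℚ := GeneralLinearGroup.mkOfDetNeZero
    !![1, ((B 0 0 : ℤ) : ℚ); 0, ((B 1 0 : ℤ) : ℚ)] (by simpa [det_fin_two_of] using hB)
  suffices h : (toGLRat B : Matrix (Fin 2) (Fin 2) ℚ) * P =
      P * !![0, -1; 1, ((B : Matrix (Fin 2) (Fin 2) ℤ).trace : ℚ)] by
    refine ⟨P, ?_⟩
    rw [Units.val_mul, Units.val_mul, mul_assoc, h, ← mul_assoc, ← Units.val_mul, inv_mul_cancel,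
      Units.val_one, one_mul]
  change (B : Matrix (Fin 2) (Fin 2) ℤ).map (Int.cast : ℤ → ℚ) *
    !![1, ((B 0 0 : ℤ) : ℚ); 0, ((B 1 0 : ℤ) : ℚ)] =
      !![1, ((B 0 0 : ℤ) : ℚ); 0, ((B 1 0 : ℤ) : ℚ)] * _
  ext i j
  fin_cases i <;> fin_cases j <;> simp [mul_apply, Fin.sum_univ_two, trace_fin_two]
  · linear_combination -hd
  · ring

theorem exists_conj_of_trace_eq {B₁ B₂ : SpecialLinearGroup (Fin 2) ℤ} (h₁ : B₁ 1 0 ≠ 0)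
    (h₂ : B₂ 1 0 ≠ 0) (h : (B₁ : Matrix (Fin 2) (Fin 2) ℤ).trace =
      (B₂ : Matrix (Fin 2) (Fin 2) ℤ).trace) :
    ∃ M : GL (Fin 2) ℚ, toGLRat B₁ = M * toGLRat B₂ * M⁻¹ := by
  obtain ⟨P₁, hP₁⟩ := exists_conj_companion h₁
  obtain ⟨P₂, hP₂⟩ := exists_conj_companion h₂
  rw [h, ← hP₂] at hP₁
  refine ⟨P₁ * P₂⁻¹, ?_⟩
  calc toGLRat B₁ = P₁ * (P₁⁻¹ * toGLRat B₁ * P₁) * P₁⁻¹ := by group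
    _ = P₁ * P₂⁻¹ * toGLRat B₂ * (P₁ * P₂⁻¹)⁻¹ := by rw [Units.ext hP₁]; group

theorem trace_eq_of_conj {B₁ B₂ : SpecialLinearGroup (Fin 2) ℤ} {M : GL (Fin 2) ℚ}
    (h : toGLRat B₁ = M * toGLRat B₂ * M⁻¹) :
    (B₁ : Matrix (Fin 2) (Fin 2) ℤ).trace = (B₂ : Matrix (Fin 2) (Fin 2) ℤ).trace := by
  have h1 := congrArg (fun A : GL (Fin 2) ℚ => (A : Matrix (Fin 2) (Fin 2) ℚ).trace) h
  simp only [Units.val_mul] at h1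
  rw [trace_mul_comm, ← mul_assoc, ← Units.val_mul, inv_mul_cancel, Units.val_one, one_mul,
    coe_toGLRat, coe_toGLRat] at h1
  simp only [trace_fin_two, map_apply] at h1 ⊢
  exact_mod_cast h1

theorem powersConj_iff {B₁ B₂ : SpecialLinearGroup (Fin 2) ℤ}
    (h₁ : 2 < (B₁ : Matrix (Fin 2) (Fin 2) ℤ).trace)
    (h₂ : 2 < (B₂ : Matrix (Fin 2) (Fin 2) ℤ).trace) :
    PowersConj B₁ B₂ ↔ ∃ m n : ℤ, m ≠ 0 ∧ n ≠ 0 ∧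
      ((B₁ ^ m : SpecialLinearGroup (Fin 2) ℤ) : Matrix (Fin 2) (Fin 2) ℤ).trace =
        ((B₂ ^ n : SpecialLinearGroup (Fin 2) ℤ) : Matrix (Fin 2) (Fin 2) ℤ).trace := by
  constructor
  · rintro ⟨m, n, hm, hn, M, hM⟩
    rw [← toGLRat_zpow, ← toGLRat_zpow] at hM
    exact ⟨m, n, hm, hn, trace_eq_of_conj hM⟩
  · rintro ⟨m, n, hm, hn, h⟩
    obtain ⟨M, hM⟩ := exists_conj_of_trace_eq (lower_left_ne_zero (two_lt_trace_zpow h₁ hm))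
      (lower_left_ne_zero (two_lt_trace_zpow h₂ hn)) h
    rw [toGLRat_zpow, toGLRat_zpow] at hM
    exact ⟨m, n, hm, hn, M, hM⟩

/-! ### Commensurable groups have conjugate powers -/

section Osc

variable {r : ℕ} {B : SpecialLinearGroup (Fin 2) ℤ} {l : Fin 2 → ℤ}

theorem vec_mul_left (a b : Osc r B l) :
    vec (a * b).left = vec a.left +
      ((B ^ a.right.toAdd : SpecialLinearGroup (Fin 2) ℤ) : Matrix (Fin 2) (Fin 2) ℤ) *ᵥ
        vec b.left := by
  rw [SemidirectProduct.mul_left, vec_mul, zpowersHom_apply, vec_aut_zpow (vec_oscAut B l)]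

theorem vec_inv_left (a : Osc r B l) :
    vec a⁻¹.left = -(((B ^ (-a.right.toAdd) : SpecialLinearGroup (Fin 2) ℤ) :
      Matrix (Fin 2) (Fin 2) ℤ) *ᵥ vec a.left) := by
  rw [SemidirectProduct.inv_left, zpowersHom_apply, vec_aut_zpow (vec_oscAut B l), vec_inv,
    mulVec_neg, toAdd_inv]

/-- The Heisenberg part of g cancels because ℤ² is abelian; only its δ-component acts. -/
theorem vec_conj_left (g : Osc r B l) {v : Osc r B l} (hv : v.right = 1) :
    vec (g * v * g⁻¹).left =
      ((B ^ g.right.toAdd : SpecialLinearGroup (Fin 2) ℤ) : Matrix (Fin 2) (Fin 2) ℤ) *ᵥ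
        vec v.left := by
  rw [vec_mul_left, vec_mul_left, vec_inv_left, SemidirectProduct.mul_right, hv, mul_one,
    mulVec_neg, mulVec_mulVec, ← Matrix.SpecialLinearGroup.coe_mul, ← _root_.zpow_add]
  simp

theorem left_zpow {v : Osc r B l} (hv : v.right = 1) (n : ℤ) :
    (v ^ n).left = v.left ^ n ∧ (v ^ n).right = 1 := by
  obtain ⟨w, rfl⟩ : ∃ w, v = SemidirectProduct.inl w :=
    ⟨v.left, SemidirectProduct.ext rfl hv⟩
  rw [← map_zpow]
  exact ⟨rfl, rfl⟩

theorem oscAut_zpow_γ (n : ℤ) : (oscAut r B l ^ n) (hγ r) = hγ r := by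
  have : oscAut r B l ∈ MulAction.stabilizer (MulAut (Heis r)) (hγ r) := oscHom_γ r B l
  exact Subgroup.zpow_mem _ this n

theorem commute_of_vec_left_eq_zero {v : Osc r B l} (hv : v.right = 1) (h0 : vec v.left = 0)
    (g : Osc r B l) : g * v = v * g := by
  ext1
  · rw [SemidirectProduct.mul_left, SemidirectProduct.mul_left, hv, map_one, MulAut.one_apply,
      ← commute_of_vec_eq_zero h0, zpowersHom_apply, eq_zpow_of_vec_eq_zero h0, map_zpow,
      oscAut_zpow_γ]
  · rw [SemidirectProduct.mul_right, SemidirectProduct.mul_right, mul_comm]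

theorem exists_inr_mem {K : Subgroup (Osc r B l)} (hK : K.FiniteIndex) :
    ∃ n : ℕ, n ≠ 0 ∧ SemidirectProduct.inr (Multiplicative.ofAdd (n : ℤ)) ∈ K := by
  obtain ⟨n, hn, -, h⟩ := Subgroup.exists_pow_mem_of_index_ne_zero hK.index_ne_zero
    (SemidirectProduct.inr (Multiplicative.ofAdd (1 : ℤ)) : Osc r B l)
  refine ⟨n, hn.ne', ?_⟩
  rw [← map_pow, ← ofAdd_nsmul] at h
  simpa using h

/-- K contains some δ ^ n with n ≠ 0, and B ^ n fixes no nonzero vector. With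
`commute_of_vec_left_eq_zero`, for elements with trivial δ-component, having zero image in ℤ² is the
same as centralizing K, a condition that isomorphisms preserve. -/
theorem vec_left_eq_zero_of_commute (hB : 2 < (B : Matrix (Fin 2) (Fin 2) ℤ).trace)
    {K : Subgroup (Osc r B l)} (hK : K.FiniteIndex) {v : Osc r B l} (hv : v.right = 1)
    (h : ∀ g ∈ K, g * v = v * g) : vec v.left = 0 := by
  obtain ⟨n, hn, hnK⟩ := exists_inr_mem hK
  have h1 := vec_conj_left (SemidirectProduct.inr (Multiplicative.ofAdd (n : ℤ))) hv
  rw [h _ hnK, mul_inv_cancel_right] at h1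
  refine eq_zero_of_mulVec_eq_self
    (two_lt_trace_zpow hB (m := n) (by exact_mod_cast hn)).ne' h1.symm

end Osc

theorem exists_trace_eq_of_commensurable {r₁ r₂ : ℕ} {B₁ B₂ : SpecialLinearGroup (Fin 2) ℤ}
    {l₁ l₂ : Fin 2 → ℤ} (h₁ : 2 < (B₁ : Matrix (Fin 2) (Fin 2) ℤ).trace)
    (h₂ : 2 < (B₂ : Matrix (Fin 2) (Fin 2) ℤ).trace)
    (h : AbstractlyCommensurable (Osc r₁ B₁ l₁) (Osc r₂ B₂ l₂)) :
    ∃ m n : ℤ, m ≠ 0 ∧ n ≠ 0 ∧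
      ((B₁ ^ m : SpecialLinearGroup (Fin 2) ℤ) : Matrix (Fin 2) (Fin 2) ℤ).trace =
        ((B₂ ^ n : SpecialLinearGroup (Fin 2) ℤ) : Matrix (Fin 2) (Fin 2) ℤ).trace := by
  obtain ⟨K₁, K₂, hK₁, hK₂, ⟨f⟩⟩ := h
  obtain ⟨m, hm, hmK⟩ := exists_inr_mem hK₁
  obtain ⟨k, hk, -, hkK⟩ := Subgroup.exists_pow_mem_of_index_ne_zero hK₁.index_ne_zero
    (SemidirectProduct.inl (hα r₁) : Osc r₁ B₁ l₁)
  rw [← map_pow] at hkK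
  have hmZ : (m : ℤ) ≠ 0 := by exact_mod_cast hm
  have ht := two_lt_trace_zpow h₁ hmZ
  -- `g` acts by `A`, and `v` is a non-central element of the commutator subgroup
  set g : K₁ := ⟨_, hmK⟩ with hg
  set a : K₁ := ⟨_, hkK⟩ with ha
  set v : K₁ := g * a * g⁻¹ * a⁻¹ with hv
  set A := B₁ ^ (m : ℤ) with hA
  set t := (A : Matrix (Fin 2) (Fin 2) ℤ).trace with htdef
  have hcomm : ∀ x y : K₂, (x * y * x⁻¹ * y⁻¹ : K₂).1.right = 1 := by
    intro x y
    simp only [Subgroup.coe_mul, Subgroup.coe_inv, SemidirectProduct.mul_right,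
      SemidirectProduct.inv_right]
    rw [mul_comm x.1.right, mul_inv_cancel_right, mul_inv_cancel]
  have hvr : v.1.right = 1 := by simp [hv, hg, ha]
  have hfvr : (f v).1.right = 1 := by
    rw [hv, map_mul, map_mul, map_mul, map_inv, map_inv]
    exact hcomm _ _
  have hgA : ∀ u : Osc r₁ B₁ l₁, u.right = 1 → vec (g.1 * u * g.1⁻¹).left =
      (A : Matrix (Fin 2) (Fin 2) ℤ) *ᵥ vec u.left := fun u hu => vec_conj_left g.1 hu
  have conj_right : ∀ {r : ℕ} {B : SpecialLinearGroup (Fin 2) ℤ} {l : Fin 2 → ℤ}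
      (x y : Osc r B l), y.right = 1 → (x * y * x⁻¹).right = 1 := by
    intro r B l x y hy
    simp [hy]
  -- This vector is (A - 1)(k e₁), and 1 is not an eigenvalue of A.
  have hvne : vec v.1.left ≠ 0 := by
    intro h0
    have har : a.1.right = 1 := rfl
    have h3 : vec v.1.left = (A : Matrix (Fin 2) (Fin 2) ℤ) *ᵥ vec a.1.left - vec a.1.left := by
      rw [hv]
      simp only [Subgroup.coe_mul, Subgroup.coe_inv]
      rw [vec_mul_left, hgA _ har, conj_right _ _ har, vec_inv_left, har]
      simp [sub_eq_add_neg]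
    have h4 := eq_zero_of_mulVec_eq_self ht.ne' (sub_eq_zero.1 (h3.symm.trans h0))
    have h5 : (toModel r₁ (hα r₁ ^ k)).x = 0 := congrFun h4 0
    simp [← zpow_natCast, toModel_α, Model.zpow_eq] at h5
    exact hk.ne' h5
  -- the relation given by the characteristic polynomial of `A`
  have hrel : ∀ {r : ℕ} {B : SpecialLinearGroup (Fin 2) ℤ} {l : Fin 2 → ℤ}
      {x y : Osc r B l}, y.right = 1 →
      (x * (x * y * x⁻¹) * x⁻¹ * (x * y * x⁻¹) ^ (-t) * y).right = 1 ∧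
      vec (x * (x * y * x⁻¹) * x⁻¹ * (x * y * x⁻¹) ^ (-t) * y).left =
        (((B ^ x.right.toAdd : SpecialLinearGroup (Fin 2) ℤ) : Matrix (Fin 2) (Fin 2) ℤ).trace -
          t) • (((B ^ x.right.toAdd : SpecialLinearGroup (Fin 2) ℤ) : Matrix (Fin 2) (Fin 2) ℤ) *ᵥ
            vec y.left) := by
    intro r B l x y hy
    have h3 := conj_right x y hy
    have h4 := conj_right x _ h3
    have h5 := left_zpow h3 (-t)
    constructor
    · rw [SemidirectProduct.mul_right, SemidirectProduct.mul_right, h4, h5.2, hy]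
      simp
    · rw [vec_mul_left _ y, vec_mul_left _ ((x * y * x⁻¹) ^ (-t)),
        SemidirectProduct.mul_right _ ((x * y * x⁻¹) ^ (-t)), h4, h5.2, h5.1, vec_zpow,
        vec_conj_left x h3, vec_conj_left x hy, mulVec_mulVec_eq]
      simp only [mul_one, toAdd_one, zpow_zero, Matrix.SpecialLinearGroup.coe_one, one_mulVec,
        neg_smul, sub_smul]
      abel
  have hcentral : ∀ x : K₁, x.1.right = 1 → vec x.1.left = 0 → (f x).1.right = 1 →
      vec (f x).1.left = 0 := by
    intro x hx h0 hfx
    refine vec_left_eq_zero_of_commute h₂ hK₂ hfx fun y hy => ?_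
    have h3 : f.symm ⟨y, hy⟩ * x = x * f.symm ⟨y, hy⟩ :=
      Subtype.ext (commute_of_vec_left_eq_zero hx h0 _)
    have h4 := congrArg f h3
    rw [map_mul, map_mul, MulEquiv.apply_symm_apply] at h4
    exact congrArg Subtype.val h4
  have hfvne : vec (f v).1.left ≠ 0 := by
    intro h0
    refine hvne (vec_left_eq_zero_of_commute h₁ hK₁ hvr fun y hy => ?_)
    have h3 : f ⟨y, hy⟩ * f v = f v * f ⟨y, hy⟩ :=
      Subtype.ext (commute_of_vec_left_eq_zero hfvr h0 _)
    rw [← map_mul, ← map_mul] at h3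
    exact congrArg Subtype.val (f.injective h3)
  have hX := hrel (x := g.1) hvr
  have hY := hrel (x := (f g).1) hfvr
  have h6 := hcentral (g * (g * v * g⁻¹) * g⁻¹ * (g * v * g⁻¹) ^ (-t) * v) hX.1
    (by
      refine hX.2.trans ?_
      rw [show B₁ ^ g.1.right.toAdd = A from rfl, sub_self, zero_smul])
    (by
      simp only [map_mul, map_inv, map_zpow]
      exact hY.1)
  simp only [map_mul, map_inv, map_zpow] at h6
  have h7 := hY.2.symm.trans h6
  -- The image of the central word is (tr B₂ ^ n - t) times a nonzero vector, with n the δ-exponent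
  -- of `f g`; so the scalar vanishes. If n were 0, then t would be 2.
  have h8 := (smul_eq_zero.1 h7).resolve_right fun h9 => hfvne (eq_zero_of_mulVec_eq_zero h9)
  refine ⟨m, (f g).1.right.toAdd, hmZ, fun h0 => ?_, (sub_eq_zero.1 h8).symm⟩
  rw [h0, zpow_zero, Matrix.SpecialLinearGroup.coe_one, trace_one] at h8
  simp at h8
  omega

/-! ### Subgroups of finite index -/

/-- The products of a lift of a representative of Q / p(K) with a representative of N / i⁻¹(K) meet
every coset of K. -/
theorem finiteIndex_of_extension {N G Q : Type*} [Group N] [Group G] [Group Q] {i : N →* G}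
    {p : G →* Q} (hp : Function.Surjective p) (hip : i.range = p.ker) {K : Subgroup G}
    (h₁ : (K.comap i).FiniteIndex) (h₂ : (K.map p).FiniteIndex) : K.FiniteIndex := by
  choose s hs using hp
  suffices h : Function.Surjective
      fun c : (Q ⧸ K.map p) × (N ⧸ K.comap i) => (↑(s c.1.out * i c.2.out) : G ⧸ K) by
    have : Finite (G ⧸ K) := Finite.of_surjective _ h
    exact Subgroup.finiteIndex_of_finite_quotient
  intro x
  obtain ⟨g, rfl⟩ := QuotientGroup.mk_surjective x
  set q : Q := (QuotientGroup.mk (p g) : Q ⧸ K.map p).out with hq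
  obtain ⟨k, hk, hkq⟩ : q⁻¹ * p g ∈ K.map p :=
    QuotientGroup.eq.1 (by rw [hq, QuotientGroup.out_eq'])
  obtain ⟨n, hn⟩ : (s q)⁻¹ * g * k⁻¹ ∈ i.range := by
    rw [hip, MonoidHom.mem_ker, map_mul, map_mul, map_inv, map_inv, hs, hkq, mul_inv_cancel]
  refine ⟨(QuotientGroup.mk (p g), QuotientGroup.mk n), QuotientGroup.eq.2 ?_⟩
  have h3 : (QuotientGroup.mk n : N ⧸ K.comap i).out⁻¹ * n ∈ K.comap i :=
    QuotientGroup.eq.1 (by rw [QuotientGroup.out_eq'])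
  have h4 := K.mul_mem h3 hk
  rw [map_mul, map_inv, hn] at h4
  rw [← hq]
  convert h4 using 1
  group

theorem finiteIndex_of_zpow_mem {A : Type*} [CommGroup A] [Group.FG A] {K : Subgroup A} {n : ℤ}
    (hn : n ≠ 0) (h : ∀ a : A, a ^ n ∈ K) : K.FiniteIndex := by
  have : Finite (A ⧸ K) := by
    apply CommGroup.finite_of_fg_isMulTorsion
    intro x
    obtain ⟨a, rfl⟩ := QuotientGroup.mk_surjective x
    rw [isOfFinOrder_iff_zpow_eq_one]
    exact ⟨n, hn, (QuotientGroup.eq_one_iff _).2 (h a)⟩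
  exact Subgroup.finiteIndex_of_finite_quotient

theorem abstractlyCommensurable_of_injective {G₁ G₂ : Type*} [Group G₁] [Group G₂] {f : G₁ →* G₂}
    (hf : Function.Injective f) (h : f.range.FiniteIndex) : AbstractlyCommensurable G₁ G₂ :=
  ⟨⊤, f.range, inferInstance, h, ⟨Subgroup.topEquiv.trans (MonoidHom.ofInjective hf)⟩⟩

/-! ### Commensurability of semidirect products with `ℤ` -/

theorem comp_zpow_eq {H₁ H₂ : Type*} [Group H₁] [Group H₂] {θ : H₁ →* H₂} {f₁ : MulAut H₁}
    {f₂ : MulAut H₂} (h : ∀ x, θ (f₁ x) = f₂ (θ x)) (k : ℤ) (x : H₁) :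
    θ ((f₁ ^ k) x) = (f₂ ^ k) (θ x) := by
  have hinv : ∀ x, θ (f₁⁻¹ x) = f₂⁻¹ (θ x) := by
    intro x
    apply f₂.injective
    rw [← h, MulAut.apply_inv_self, MulAut.apply_inv_self]
  induction k using Int.induction_on generalizing x with
  | zero => simp
  | succ n ih =>
    rw [_root_.zpow_add, _root_.zpow_add, zpow_one, zpow_one, MulAut.mul_apply, ih, h,
      MulAut.mul_apply]
  | pred n ih =>
    rw [sub_eq_add_neg, _root_.zpow_add, _root_.zpow_add, _root_.zpow_neg_one,
      _root_.zpow_neg_one, MulAut.mul_apply, ih, hinv, MulAut.mul_apply]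

/-- The map θ ⋊ (δ ↦ δ ^ m) embeds with finite index. It serves twice: with θ the identity to
replace B by a power, and with m = 1 to change the Heisenberg group. -/
theorem abstractlyCommensurable_semidirect {H₁ H₂ : Type*} [Group H₁] [Group H₂] {θ : H₁ →* H₂}
    (hθ : Function.Injective θ) (hfin : θ.range.FiniteIndex) {f₁ : MulAut H₁} {f₂ : MulAut H₂}
    {m : ℤ} (hm : m ≠ 0) (h : ∀ x, θ (f₁ x) = (f₂ ^ m) (θ x)) :
    AbstractlyCommensurable (H₁ ⋊[zpowersHom _ f₁] Multiplicative ℤ)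
      (H₂ ⋊[zpowersHom _ f₂] Multiplicative ℤ) := by
  let F : H₁ ⋊[zpowersHom _ f₁] Multiplicative ℤ →* H₂ ⋊[zpowersHom _ f₂] Multiplicative ℤ :=
    SemidirectProduct.map θ (zpowGroupHom m) (by
      intro g
      ext x
      change θ ((zpowersHom _ f₁ g) x) = (zpowersHom _ f₂ (g ^ m)) (θ x)
      rw [zpowersHom_apply, zpowersHom_apply, comp_zpow_eq h, toAdd_zpow, ← _root_.zpow_mul,
        smul_eq_mul])
  apply abstractlyCommensurable_of_injective (f := F)
  · intro x y hxy
    apply SemidirectProduct.ext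
    · exact hθ (congrArg SemidirectProduct.left hxy)
    · have h1 : x.right ^ m = y.right ^ m := congrArg SemidirectProduct.right hxy
      have h2 := congrArg Multiplicative.toAdd h1
      rw [toAdd_zpow, toAdd_zpow, smul_eq_mul, smul_eq_mul] at h2
      exact Multiplicative.toAdd.injective (mul_left_cancel₀ hm h2)
  · apply finiteIndex_of_extension SemidirectProduct.rightHom_surjective
      SemidirectProduct.range_inl_eq_ker_rightHom
    · refine Subgroup.finiteIndex_of_le (H := θ.range) ?_
      rintro _ ⟨x, rfl⟩
      exact ⟨SemidirectProduct.inl x, SemidirectProduct.map_inl _ _ _ x⟩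
    · refine finiteIndex_of_zpow_mem hm fun a => ?_
      exact ⟨_, ⟨SemidirectProduct.inr a, rfl⟩, rfl⟩

theorem abstractlyCommensurable_zpow {r : ℕ} (hr : 0 < r) (B : SpecialLinearGroup (Fin 2) ℤ)
    (l : Fin 2 → ℤ) {m : ℤ} (hm : m ≠ 0) :
    ∃ l', AbstractlyCommensurable (Osc r (B ^ m) l') (Osc r B l) := by
  obtain ⟨l', hl'⟩ := exists_eq_oscAut hr (vec_aut_zpow (vec_oscAut B l) m)
  refine ⟨l', abstractlyCommensurable_semidirect (θ := MonoidHom.id _) Function.injective_id ?_ hm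
    fun x => ?_⟩
  · rw [MonoidHom.range_eq_top_of_surjective _ Function.surjective_id]
    infer_instance
  · rw [hl']
    rfl

/-! ### Homomorphisms between discrete Heisenberg groups -/

section heisHom

variable {r₁ r₂ : ℕ} {M : Matrix (Fin 2) (Fin 2) ℤ} {k : ℤ}

/-- The homomorphism `H^{r₁}(ℤ) → H^{r₂}(ℤ)` that induces `M` on `ℤ²` and the multiplication by `k`
on the centers. -/
def heisHom (h : r₁ * k = r₂ * M.det) (p q : ℤ) : Heis r₁ →* Heis r₂ :=
  PresentedGroup.toGroup (f := ![hα r₂ ^ M 0 0 * hβ r₂ ^ M 1 0 * hγ r₂ ^ p,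
    hα r₂ ^ M 0 1 * hβ r₂ ^ M 1 1 * hγ r₂ ^ q, hγ r₂ ^ k]) (by
    rw [det_fin_two] at h
    apply lift_rels <;> apply (heisEquiv r₂).injective <;>
      simp only [heisEquiv_apply, cons_val_zero, cons_val_one, cons_val, map_mul, map_inv,
        ← zpow_natCast, map_zpow, toModel_α, toModel_β, toModel_γ, Model.zpow_eq] <;>
      ext <;> simp <;> ring_nf
    linear_combination -h)

variable (h : r₁ * k = r₂ * M.det) (p q : ℤ)

theorem toModel_heisHom (g : Heis r₁) :
    toModel r₂ (heisHom h p q g) =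
      ⟨M 0 0 * (toModel r₁ g).x + M 0 1 * (toModel r₁ g).y,
        M 1 0 * (toModel r₁ g).x + M 1 1 * (toModel r₁ g).y,
        k * (toModel r₁ g).z + p * (toModel r₁ g).x + q * (toModel r₁ g).y -
        r₂ * (M 0 0 * M 1 0 * Model.tri (toModel r₁ g).x +
          M 0 1 * M 1 1 * Model.tri (toModel r₁ g).y +
          M 0 1 * M 1 0 * ((toModel r₁ g).x * (toModel r₁ g).y))⟩ := by
  have hα' : heisHom h p q (hα r₁) = hα r₂ ^ M 0 0 * hβ r₂ ^ M 1 0 * hγ r₂ ^ p :=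
    PresentedGroup.toGroup.of _
  have hβ' : heisHom h p q (hβ r₁) = hα r₂ ^ M 0 1 * hβ r₂ ^ M 1 1 * hγ r₂ ^ q :=
    PresentedGroup.toGroup.of _
  have hγ' : heisHom h p q (hγ r₁) = hγ r₂ ^ k := PresentedGroup.toGroup.of _
  conv_lhs => rw [eq_normal g]
  simp only [map_mul, map_zpow, hα', hβ', hγ', toModel_α, toModel_β, toModel_γ, Model.zpow_eq]
  ext <;> simp <;> ring

theorem vec_heisHom (g : Heis r₁) : vec (heisHom h p q g) = M *ᵥ vec g := by
  ext i
  fin_cases i <;> simp [toModel_heisHom, mulVec, dotProduct, Fin.sum_univ_two]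

theorem heisHom_injective (hk : k ≠ 0) (hM : M.det ≠ 0) :
    Function.Injective (heisHom h p q) := by
  rw [injective_iff_map_eq_one]
  intro g hg
  have h0 : vec g = 0 := by
    by_contra hne
    refine hM (exists_mulVec_eq_zero_iff.1 ⟨vec g, hne, ?_⟩)
    rw [← vec_heisHom h p q, hg, vec_one]
  have h1 := congrArg (fun x => (toModel r₂ x).z) hg
  have hx : (toModel r₁ g).x = 0 := congrFun h0 0
  have hy : (toModel r₁ g).y = 0 := congrFun h0 1
  simp only [toModel_heisHom, hx, hy, map_one, Model.one_z, mul_zero, add_zero, Model.tri_zero,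
    sub_zero, mul_eq_zero, hk, false_or] at h1
  rw [eq_zpow_of_vec_eq_zero h0, h1, zpow_zero]

theorem finiteIndex_range_heisHom (hk : k ≠ 0) (hM : M.det ≠ 0) :
    (heisHom h p q).range.FiniteIndex := by
  have hγ' : heisHom h p q (hγ r₁) = hγ r₂ ^ k := PresentedGroup.toGroup.of _
  have hker : (zpowersHom _ (hγ r₂)).range = (vecHom r₂).ker := by
    ext g
    constructor
    · rintro ⟨n, rfl⟩
      change vec (hγ r₂ ^ n.toAdd) = 0
      rw [vec_zpow, vec_γ, smul_zero]
    · intro hg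
      exact ⟨Multiplicative.ofAdd (toModel r₂ g).z, (eq_zpow_of_vec_eq_zero hg).symm⟩
  apply finiteIndex_of_extension vecHom_surjective hker
  · refine finiteIndex_of_zpow_mem hk fun a => ⟨hγ r₁ ^ a.toAdd, ?_⟩
    rw [map_zpow, hγ', map_zpow, zpowersHom_apply, ← _root_.zpow_mul, ← _root_.zpow_mul, mul_comm]
  · have : Group.FG (Multiplicative (Fin 2 → ℤ)) :=
      inferInstance
    refine finiteIndex_of_zpow_mem hM fun a => ?_
    -- M · adj M = det M, so the image contains det M · ℤ².
    obtain ⟨g, hg⟩ := vecHom_surjective (r := r₁) (Multiplicative.ofAdd (M.adjugate *ᵥ a.toAdd))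
    refine ⟨_, ⟨g, rfl⟩, ?_⟩
    apply Multiplicative.toAdd.injective
    have hg' : vec g = M.adjugate *ᵥ a.toAdd := hg
    change vec (heisHom h p q g) = M.det • a.toAdd
    rw [vec_heisHom, hg', mulVec_mulVec, mul_adjugate, smul_mulVec, one_mulVec]

end heisHom

theorem toModel_oscAut {r : ℕ} (B : SpecialLinearGroup (Fin 2) ℤ) (l : Fin 2 → ℤ) (g : Heis r) :
    toModel r (oscAut r B l g) =
      ⟨B 0 0 * (toModel r g).x + B 0 1 * (toModel r g).y,
        B 1 0 * (toModel r g).x + B 1 1 * (toModel r g).y,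
        (toModel r g).z - l 1 * (toModel r g).x + l 0 * (toModel r g).y -
        r * (B 0 0 * B 1 0 * Model.tri (toModel r g).x + B 0 1 * B 1 1 * Model.tri (toModel r g).y +
          B 0 1 * B 1 0 * ((toModel r g).x * (toModel r g).y))⟩ := by
  rw [← toModel_oscHom]
  change toModel r (oscHom r B l g) = toModel r (oscHom r B l (ofModel r (toModel r g)))
  rw [ofModel_toModel]

theorem tri_two_mul (n : ℤ) : Model.tri (2 * n) = n * (2 * n - 1) := by
  have := Model.two_tri (2 * n)
  linarith

/-- If `M` intertwines `A₁` and `A₂` and is sufficiently divisible, then it lifts to a homomorphism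
of Heisenberg groups that intertwines the automorphisms defining `Osc^r(A, l)`. -/
theorem exists_heisHom_intertwining {r₁ r₂ : ℕ} {A₁ A₂ : SpecialLinearGroup (Fin 2) ℤ}
    (l₁ l₂ : Fin 2 → ℤ) {M : Matrix (Fin 2) (Fin 2) ℤ} {k d : ℤ}
    (hd : (A₁ : Matrix (Fin 2) (Fin 2) ℤ).trace - 2 = d)
    (h : r₁ * (d * k) = r₂ * ((2 * d) • M).det)
    (hM : M * A₁ = A₂ * M) :
    ∃ p q : ℤ, ∀ x, heisHom h p q (oscAut r₁ A₁ l₁ x) = oscAut r₂ A₂ l₂ (heisHom h p q x) := by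
  have hdet := det_eq A₁
  rw [trace_fin_two] at hd
  have h00 := congrFun (congrFun hM 0) 0
  have h01 := congrFun (congrFun hM 0) 1
  have h10 := congrFun (congrFun hM 1) 0
  have h11 := congrFun (congrFun hM 1) 1
  simp only [mul_apply, Fin.sum_univ_two] at h00 h01 h10 h11
  let e₁ : ℤ := k * l₁ 1 + r₂ * (4 * d * (
      M 0 0 * M 1 0 * Model.tri (A₁ 0 0) + M 0 1 * M 1 1 * Model.tri (A₁ 1 0) +
      M 0 1 * M 1 0 * (A₁ 0 0 * A₁ 1 0))) - l₂ 1 * (2 * M 0 0) + l₂ 0 * (2 * M 1 0) -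
      r₂ * (A₂ 0 0 * A₂ 1 0 * (M 0 0 * (2 * (d * M 0 0) - 1)) +
        A₂ 0 1 * A₂ 1 1 * (M 1 0 * (2 * (d * M 1 0) - 1)) +
        A₂ 0 1 * A₂ 1 0 * (4 * d * (M 0 0 * M 1 0)))
  let e₂ : ℤ := -k * l₁ 0 + r₂ * (4 * d * (
      M 0 0 * M 1 0 * Model.tri (A₁ 0 1) + M 0 1 * M 1 1 * Model.tri (A₁ 1 1) +
      M 0 1 * M 1 0 * (A₁ 0 1 * A₁ 1 1))) - l₂ 1 * (2 * M 0 1) + l₂ 0 * (2 * M 1 1) -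
      r₂ * (A₂ 0 0 * A₂ 1 0 * (M 0 1 * (2 * (d * M 0 1) - 1)) +
        A₂ 0 1 * A₂ 1 1 * (M 1 1 * (2 * (d * M 1 1) - 1)) +
        A₂ 0 1 * A₂ 1 0 * (4 * d * (M 0 1 * M 1 1)))
  -- Solves (p, q)(A₁ - 1) = d (e₁, e₂) by the adjugate; since det(A₁ - 1) = 2 - tr A₁ = -d, the
  -- solution is integral.
  let p := -((A₁ 1 1 - 1) * e₁ - A₁ 1 0 * e₂)
  let q := -((A₁ 0 0 - 1) * e₂ - A₁ 0 1 * e₁)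
  have hp : p * (A₁ 0 0 - 1) + q * A₁ 1 0 = d * e₁ := by
    simp only [p, q]
    linear_combination (-e₁) * hdet + e₁ * hd
  have hq : p * A₁ 0 1 + q * (A₁ 1 1 - 1) = d * e₂ := by
    simp only [p, q]
    linear_combination (-e₂) * hdet + e₂ * hd
  refine ⟨p, q, DFunLike.congr_fun (f := (heisHom h p q).comp (oscAut r₁ A₁ l₁).toMonoidHom)
    (g := (oscAut r₂ A₂ l₂).toMonoidHom.comp (heisHom h p q)) (hom_ext_heis ?_ ?_ ?_)⟩
  all_goals
    apply (heisEquiv r₂).injective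
    simp only [heisEquiv_apply, MonoidHom.comp_apply, MulEquiv.coe_toMonoidHom, toModel_heisHom,
      toModel_oscAut, toModel_α, toModel_β, toModel_γ]
    ext <;> simp [mul_assoc, tri_two_mul, Model.tri_zero, Model.tri_one]
  · linear_combination (2 * d) * h00
  · linear_combination (2 * d) * h10
  · linear_combination hp
  · linear_combination (2 * d) * h01
  · linear_combination (2 * d) * h11
  · linear_combination hq

theorem abstractlyCommensurable_of_intertwining {r₁ r₂ : ℕ} (hr₁ : 0 < r₁) (hr₂ : 0 < r₂)
    {A₁ A₂ : SpecialLinearGroup (Fin 2) ℤ} (l₁ l₂ : Fin 2 → ℤ)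
    (hA : 2 < (A₁ : Matrix (Fin 2) (Fin 2) ℤ).trace) {M : Matrix (Fin 2) (Fin 2) ℤ}
    (hdet : M.det ≠ 0) (hM : M * A₁ = A₂ * M) :
    AbstractlyCommensurable (Osc r₁ A₁ l₁) (Osc r₂ A₂ l₂) := by
  set d := (A₁ : Matrix (Fin 2) (Fin 2) ℤ).trace - 2 with hd
  have hd0 : d ≠ 0 := by omega
  have hr₁' : (r₁ : ℤ) ≠ 0 := by exact_mod_cast hr₁.ne'
  have hr₂' : (r₂ : ℤ) ≠ 0 := by exact_mod_cast hr₂.ne'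
  have hdet' : ((2 * d) • (r₁ : ℤ) • M).det = (2 * d) ^ 2 * (r₁ ^ 2 * M.det) := by
    rw [det_smul, det_smul, Fintype.card_fin]
  -- Scaling M by r₁ makes the determinant divisible by r₁, as the relation between the two centers
  -- requires.
  have h : r₁ * (d * (4 * d * r₁ * r₂ * M.det)) = r₂ * ((2 * d) • (r₁ : ℤ) • M).det := by
    rw [hdet']
    ring
  obtain ⟨p, q, hpq⟩ := exists_heisHom_intertwining (A₂ := A₂) l₁ l₂ hd.symm h
    (by rw [smul_mul, hM, Matrix.mul_smul])
  have hk : d * (4 * d * r₁ * r₂ * M.det) ≠ 0 := by positivity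
  have hne : ((2 * d) • (r₁ : ℤ) • M).det ≠ 0 := by
    rw [hdet']
    positivity
  exact abstractlyCommensurable_semidirect (heisHom_injective h p q hk hne)
    (finiteIndex_range_heisHom h p q hk hne) one_ne_zero (by simpa using hpq)

theorem exists_int_intertwining {B₁ B₂ : SpecialLinearGroup (Fin 2) ℤ} {M : GL (Fin 2) ℚ}
    (h : toGLRat B₁ = M * toGLRat B₂ * M⁻¹) :
    ∃ N : Matrix (Fin 2) (Fin 2) ℤ, N.det ≠ 0 ∧ N * B₂ = B₁ * N := by
  obtain ⟨⟨b, hb⟩, hN⟩ := IsLocalization.exist_integer_multiples_of_finite (nonZeroDivisors ℤ)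
    (fun ij : Fin 2 × Fin 2 => (M : Matrix (Fin 2) (Fin 2) ℚ) ij.1 ij.2)
  choose N hN using hN
  simp only at hN
  have hb0 : (b : ℚ) ≠ 0 := by exact_mod_cast nonZeroDivisors.ne_zero hb
  have hNM : (Matrix.of fun i j => N (i, j)).map (Int.cast : ℤ → ℚ) =
      (b : ℚ) • (M : Matrix (Fin 2) (Fin 2) ℚ) := by
    ext i j
    simpa using hN (i, j)
  refine ⟨Matrix.of fun i j => N (i, j), ?_, ?_⟩
  · intro h0
    have h1 := congrArg det hNM
    rw [det_smul, show (Int.cast : ℤ → ℚ) = Int.castRingHom ℚ from rfl,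
      ← RingHom.mapMatrix_apply, ← RingHom.map_det, h0,
      map_zero, eq_comm, mul_eq_zero] at h1
    rcases h1 with h1 | h1
    · exact hb0 ((pow_eq_zero_iff (by simp)).1 h1)
    · exact (GeneralLinearGroup.det M).ne_zero h1
  · have h1 : toGLRat B₁ * M = M * toGLRat B₂ := by rw [h, inv_mul_cancel_right]
    have h2 := congrArg (fun A : GL (Fin 2) ℚ => (A : Matrix (Fin 2) (Fin 2) ℚ)) h1
    simp only [Units.val_mul, coe_toGLRat] at h2
    have h3 : ((Matrix.of fun i j => N (i, j)) *
        (B₂ : Matrix (Fin 2) (Fin 2) ℤ)).map (Int.castRingHom ℚ) =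
        ((B₁ : Matrix (Fin 2) (Fin 2) ℤ) *
          (Matrix.of fun i j => N (i, j))).map (Int.castRingHom ℚ) := by
      rw [Matrix.map_mul, Matrix.map_mul]
      change Matrix.map _ (Int.cast : ℤ → ℚ) * Matrix.map _ (Int.cast : ℤ → ℚ) =
        Matrix.map _ (Int.cast : ℤ → ℚ) * Matrix.map _ (Int.cast : ℤ → ℚ)
      rw [hNM, smul_mul, ← h2, Matrix.mul_smul]
    exact Matrix.map_injective (RingHom.injective_int _) h3

theorem abstractlyCommensurable_iff_powersConj {r₁ r₂ : ℕ} (hr₁ : 0 < r₁) (hr₂ : 0 < r₂)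
    {B₁ B₂ : SpecialLinearGroup (Fin 2) ℤ} (l₁ l₂ : Fin 2 → ℤ)
    (h₁ : 2 < (B₁ : Matrix (Fin 2) (Fin 2) ℤ).trace)
    (h₂ : 2 < (B₂ : Matrix (Fin 2) (Fin 2) ℤ).trace) :
    AbstractlyCommensurable (Osc r₁ B₁ l₁) (Osc r₂ B₂ l₂) ↔ PowersConj B₁ B₂ := by
  constructor
  · exact fun h => (powersConj_iff h₁ h₂).2 (exists_trace_eq_of_commensurable h₁ h₂ h)
  · rintro ⟨m, n, hm, hn, M, hM⟩
    rw [← toGLRat_zpow, ← toGLRat_zpow] at hM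
    obtain ⟨N, hN, hNB⟩ := exists_int_intertwining hM
    obtain ⟨l₁', hl₁⟩ := abstractlyCommensurable_zpow hr₁ B₁ l₁ hm
    obtain ⟨l₂', hl₂⟩ := abstractlyCommensurable_zpow hr₂ B₂ l₂ hn
    exact hl₁.symm.trans ((abstractlyCommensurable_of_intertwining hr₂ hr₁ l₂' l₁'
      (two_lt_trace_zpow h₂ hn) hN hNB).symm.trans hl₂)

/-! ### Quadratic fields -/

/-- The field `ℚ(√d)`. -/
noncomputable def sqrtField (d : ℤ) : IntermediateField ℚ ℝ :=
  IntermediateField.adjoin ℚ {√(d : ℝ)}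

theorem sqrt_mem_sqrtField (d : ℤ) : √(d : ℝ) ∈ sqrtField d :=
  IntermediateField.mem_adjoin_simple_self ℚ _

theorem sqrtField_le_iff {d : ℤ} {K : IntermediateField ℚ ℝ} : sqrtField d ≤ K ↔ √(d : ℝ) ∈ K :=
  IntermediateField.adjoin_simple_le_iff

theorem ratCast_mem_field (K : IntermediateField ℚ ℝ) (q : ℚ) : (q : ℝ) ∈ K :=
  K.algebraMap_mem q

theorem intCast_mem_field (K : IntermediateField ℚ ℝ) (n : ℤ) : (n : ℝ) ∈ K := by
  exact_mod_cast ratCast_mem_field K n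

theorem ratCast_sq_ne {d : ℤ} (hd : ¬IsSquare d) (q : ℚ) : q ^ 2 ≠ (d : ℚ) := by
  intro h
  exact hd (Rat.isSquare_intCast_iff.1 ⟨q, by rw [← h, sq]⟩)

theorem aeval_sqrt {d : ℤ} (h0 : 0 ≤ d) :
    Polynomial.aeval (√(d : ℝ)) (Polynomial.X ^ 2 - Polynomial.C (d : ℚ)) = 0 := by
  have : (0 : ℝ) ≤ d := by exact_mod_cast h0
  simp [Real.sq_sqrt this]

theorem finrank_sqrtField {d : ℤ} (h0 : 0 ≤ d) (hd : ¬IsSquare d) :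
    Module.finrank ℚ (sqrtField d) = 2 := by
  have hirr : Irreducible (Polynomial.X ^ 2 - Polynomial.C (d : ℚ)) :=
    X_pow_sub_C_irreducible_of_prime Nat.prime_two (ratCast_sq_ne hd)
  have hmonic : (Polynomial.X ^ 2 - Polynomial.C (d : ℚ)).Monic :=
    Polynomial.monic_X_pow_sub_C _ two_ne_zero
  rw [sqrtField, IntermediateField.adjoin.finrank ⟨_, hmonic, aeval_sqrt h0⟩,
    ← minpoly.eq_of_irreducible_of_monic hirr (aeval_sqrt h0) hmonic,
    Polynomial.natDegree_X_pow_sub_C]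

theorem sqrtField_le_of_mul_sq_eq {d₁ d₂ c₁ c₂ : ℤ} (h₁ : c₁ ≠ 0)
    (h : d₁ * c₁ ^ 2 = d₂ * c₂ ^ 2) : sqrtField d₁ ≤ sqrtField d₂ := by
  have h' : (d₁ : ℝ) * (c₁ : ℝ) ^ 2 = d₂ * (c₂ : ℝ) ^ 2 := by exact_mod_cast h
  have h2 := congrArg Real.sqrt h'
  rw [Real.sqrt_mul' _ (sq_nonneg _), Real.sqrt_mul' _ (sq_nonneg _), Real.sqrt_sq_eq_abs,
    Real.sqrt_sq_eq_abs, ← Int.cast_abs, ← Int.cast_abs] at h2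
  have hc : ((|c₁| : ℤ) : ℝ) ≠ 0 := by simpa using h₁
  rw [sqrtField_le_iff, eq_div_of_mul_eq hc h2]
  exact div_mem (mul_mem (sqrt_mem_sqrtField _) (intCast_mem_field _ _)) (intCast_mem_field _ _)

theorem sqrtField_eq_of_mul_sq_eq {d₁ d₂ c₁ c₂ : ℤ} (h₁ : c₁ ≠ 0) (h₂ : c₂ ≠ 0)
    (h : d₁ * c₁ ^ 2 = d₂ * c₂ ^ 2) : sqrtField d₁ = sqrtField d₂ :=
  le_antisymm (sqrtField_le_of_mul_sq_eq h₁ h) (sqrtField_le_of_mul_sq_eq h₂ h.symm)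

theorem exists_of_mem_sqrtField {d : ℤ} (h0 : 0 ≤ d) {x : ℝ} (hx : x ∈ sqrtField d) :
    ∃ a b : ℚ, x = a + b * √(d : ℝ) := by
  have hs : √(d : ℝ) ^ 2 = d := Real.sq_sqrt (by exact_mod_cast h0)
  have hint : IsIntegral ℚ (√(d : ℝ)) :=
    ⟨_, Polynomial.monic_X_pow_sub_C _ two_ne_zero, aeval_sqrt h0⟩
  rw [sqrtField, ← IntermediateField.mem_toSubalgebra,
    IntermediateField.adjoin_simple_toSubalgebra_of_isAlgebraic hint.isAlgebraic] at hx
  induction hx using Algebra.adjoin_induction with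
  | mem x hx => exact ⟨0, 1, by simp [Set.mem_singleton_iff.1 hx]⟩
  | algebraMap q => exact ⟨q, 0, by simp⟩
  | add x y _ _ hx hy =>
    obtain ⟨a, b, rfl⟩ := hx
    obtain ⟨a', b', rfl⟩ := hy
    exact ⟨a + a', b + b', by push_cast; ring⟩
  | mul x y _ _ hx hy =>
    obtain ⟨a, b, rfl⟩ := hx
    obtain ⟨a', b', rfl⟩ := hy
    refine ⟨a * a' + b * b' * d, a * b' + a' * b, ?_⟩
    push_cast
    linear_combination (b * b' : ℝ) * hs

/-- Write √d₁ = a + b√d₂ and square: irrationality of √d₂ gives ab = 0, and b = 0 would make d₁ a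
square. So d₁ = b² d₂. -/
theorem exists_mul_sq_eq_of_sqrtField_eq {d₁ d₂ : ℤ} (h₁ : 0 ≤ d₁) (h₂ : 0 ≤ d₂)
    (hd₁ : ¬IsSquare d₁) (hd₂ : ¬IsSquare d₂) (h : sqrtField d₁ = sqrtField d₂) :
    ∃ e f : ℤ, e ≠ 0 ∧ f ≠ 0 ∧ d₁ * e ^ 2 = d₂ * f ^ 2 := by
  have hs₁ : √(d₁ : ℝ) ^ 2 = d₁ := Real.sq_sqrt (by exact_mod_cast h₁)
  have hs₂ : √(d₂ : ℝ) ^ 2 = d₂ := Real.sq_sqrt (by exact_mod_cast h₂)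
  have hirr : ∀ q : ℚ, √(d₂ : ℝ) ≠ q := by
    intro q hq
    rw [hq] at hs₂
    exact ratCast_sq_ne hd₂ q (by exact_mod_cast hs₂)
  obtain ⟨a, b, hab⟩ := exists_of_mem_sqrtField h₂ (h ▸ sqrt_mem_sqrtField d₁)
  have h3 : (d₁ : ℝ) = a ^ 2 + b ^ 2 * d₂ + 2 * a * b * √(d₂ : ℝ) := by
    rw [← hs₁, hab]
    linear_combination (b ^ 2 : ℝ) * hs₂
  have hab0 : a * b = 0 := by
    by_contra hne
    have hne' : (2 * a * b : ℝ) ≠ 0 := by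
      have : (a * b : ℝ) ≠ 0 := by exact_mod_cast hne
      rw [mul_assoc]
      positivity
    refine hirr ((d₁ - a ^ 2 - b ^ 2 * d₂) / (2 * a * b)) ?_
    push_cast
    rw [eq_div_iff hne']
    linarith
  have h4 : (d₁ : ℚ) = a ^ 2 + b ^ 2 * d₂ := by
    have : (2 * a * b : ℝ) = 0 := by
      have : (a * b : ℝ) = 0 := by exact_mod_cast hab0
      rw [mul_assoc, this, mul_zero]
    rw [this, zero_mul, add_zero] at h3
    exact_mod_cast h3
  have hb : b ≠ 0 := by
    rintro rfl
    exact ratCast_sq_ne hd₁ a (by rw [h4]; ring)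
  rw [(mul_eq_zero.1 hab0).resolve_right hb] at h4
  refine ⟨b.den, b.num, by exact_mod_cast b.den_ne_zero, Rat.num_ne_zero.2 hb, ?_⟩
  have h5 : (b.den : ℚ) ≠ 0 := by exact_mod_cast b.den_ne_zero
  have h6 : (d₁ : ℚ) * (b.den : ℚ) ^ 2 = d₂ * (b.num : ℚ) ^ 2 := by
    rw [h4, ← Rat.mul_den_eq_num b]
    ring
  exact_mod_cast h6

theorem exists_eq_sqrtField {K : IntermediateField ℚ ℝ} (hK : Module.finrank ℚ K = 2) :
    ∃ d : ℤ, 0 < d ∧ ¬IsSquare d ∧ K = sqrtField d := by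
  have hfin : FiniteDimensional ℚ K := Module.finite_of_finrank_eq_succ hK
  obtain ⟨α, hα, hαQ⟩ : ∃ α ∈ K, ∀ q : ℚ, α ≠ q := by
    by_contra! hne
    have : K = ⊥ := by
      rw [eq_bot_iff]
      intro x hx
      obtain ⟨q, rfl⟩ := hne x hx
      exact ratCast_mem_field _ q
    rw [this, IntermediateField.finrank_bot] at hK
    omega
  set P := minpoly ℚ (⟨α, hα⟩ : K) with hP
  have hP0 : P ≠ 0 := minpoly.ne_zero (IsIntegral.of_finite ℚ _)
  have hdeg : P.natDegree ≤ 2 := (minpoly.natDegree_le _).trans hK.le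
  have hroot : Polynomial.aeval α P = 0 := by
    have := congrArg (algebraMap K ℝ) (minpoly.aeval ℚ (⟨α, hα⟩ : K))
    rwa [map_zero, ← Polynomial.aeval_algebraMap_apply] at this
  rw [Polynomial.eq_quadratic_of_degree_le_two (Polynomial.natDegree_le_iff_degree_le.1 hdeg)]
    at hroot hP0
  set u := P.coeff 2
  set v := P.coeff 1
  set w := P.coeff 0
  simp only [map_add, map_mul, Polynomial.aeval_C, Polynomial.aeval_X, map_pow, eq_ratCast] at hroot
  have hu : u ≠ 0 := by
    intro hu
    rw [hu, Rat.cast_zero, zero_mul, zero_add] at hroot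
    have hv : v = 0 := by
      by_contra hv
      have hv' : (v : ℝ) ≠ 0 := by exact_mod_cast hv
      refine hαQ (-w / v) ?_
      push_cast
      rw [eq_div_iff hv']
      linarith
    rw [hv, Rat.cast_zero, zero_mul, zero_add] at hroot
    have hw : w = 0 := by exact_mod_cast hroot
    simp [hu, hv, hw] at hP0
  have hu' : (u : ℝ) ≠ 0 := by exact_mod_cast hu
  set δ : ℚ := v ^ 2 - 4 * u * w with hδ
  -- Completing the square gives (2uα + v)² = δ; the factor `δ.den` turns this into the integer
  -- `δ.num * δ.den`.
  set β : ℝ := δ.den * (2 * u * α + v) with hβ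
  have hden : (δ.den : ℝ) ≠ 0 := by exact_mod_cast δ.den_ne_zero
  have hβsq : β ^ 2 = ((δ.num * δ.den : ℤ) : ℝ) := by
    have h1 : (2 * u * α + v) ^ 2 = (δ : ℝ) := by
      rw [hδ]
      push_cast
      linear_combination (4 * u : ℝ) * hroot
    have h2 : (δ : ℝ) * δ.den = δ.num := by exact_mod_cast Rat.mul_den_eq_num δ
    rw [hβ, mul_pow, h1]
    push_cast
    rw [← h2]
    ring
  have hβK : β ∈ K := by
    have h2 : (2 : ℝ) ∈ K := by exact_mod_cast intCast_mem_field K 2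
    exact mul_mem (by exact_mod_cast intCast_mem_field K δ.den)
      (add_mem (mul_mem (mul_mem h2 (ratCast_mem_field K u)) hα) (ratCast_mem_field K v))
  have hβQ : ∀ q : ℚ, β ≠ q := by
    intro q hq
    refine hαQ ((q / δ.den - v) / (2 * u)) ?_
    push_cast
    rw [← hq, hβ]
    field_simp
    ring
  set d : ℤ := δ.num * δ.den
  have hsq : ¬IsSquare d := by
    rintro ⟨c, hc⟩
    rw [hc, Int.cast_mul, ← sq, sq_eq_sq_iff_eq_or_eq_neg] at hβsq
    rcases hβsq with h | h
    · exact hβQ c (by exact_mod_cast h)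
    · exact hβQ (-c) (by rw [h]; push_cast; rfl)
  have hd0 : 0 ≤ d := by
    have : (0 : ℝ) ≤ (d : ℝ) := hβsq ▸ sq_nonneg β
    exact_mod_cast this
  have hdpos : 0 < d := lt_of_le_of_ne hd0 fun h => hsq (h ▸ IsSquare.zero)
  refine ⟨d, hdpos, hsq, (IntermediateField.eq_of_le_of_finrank_eq ?_ ?_).symm⟩
  · rw [sqrtField_le_iff, ← hβsq, Real.sqrt_sq_eq_abs]
    rcases abs_choice β with h | h <;> rw [h]
    · exact hβK
    · exact neg_mem hβK
  · rw [finrank_sqrtField hd0 hsq, hK]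

/-! ### The field of an element of `SL(2, ℤ)` -/

/-- A root would lie strictly between t - 2 and t, and t² - 4 = (t - 1)² means 2t = 5. -/
theorem not_isSquare_sq_sub_four {t : ℤ} (ht : 2 < t) : ¬IsSquare (t ^ 2 - 4) := by
  rintro ⟨s, hs⟩
  have h1 : |s| < t := abs_lt_of_sq_lt_sq (by linarith) (by linarith)
  have h2 : t - 2 < |s| := by
    apply lt_of_pow_lt_pow_left₀ 2 (abs_nonneg s)
    rw [sq_abs]
    nlinarith
  have h3 : |s| = t - 1 := by omega
  have h4 : s ^ 2 = (t - 1) ^ 2 := by rw [← sq_abs, h3]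
  have h5 : 2 * t = 5 := by linarith
  omega

/-- The characteristic equation reads (2λ - t)² = t² - 4, so the choice of eigenvalue only affects
the sign of the square root. -/
theorem adjoin_eigenvalue {B : SpecialLinearGroup (Fin 2) ℤ} {lam : ℝ}
    (h : IsEigenvalue B lam) :
    IntermediateField.adjoin ℚ {lam} =
      sqrtField ((B : Matrix (Fin 2) (Fin 2) ℤ).trace ^ 2 - 4) := by
  have hd : ((B 0 0 : ℤ) : ℝ) * (B 1 1 : ℤ) - (B 0 1 : ℤ) * (B 1 0 : ℤ) = 1 := by
    exact_mod_cast det_eq B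
  obtain ⟨w, hw⟩ := h.exists_hasEigenvector
  have h1 := hw.apply_eq_smul
  rw [toLin'_apply] at h1
  have h2 : ((B : Matrix (Fin 2) (Fin 2) ℤ).map (Int.cast : ℤ → ℝ) - lam • 1).det = 0 := by
    rw [← exists_mulVec_eq_zero_iff]
    refine ⟨w, hw.2, ?_⟩
    rw [sub_mulVec, h1, smul_mulVec, one_mulVec, sub_self]
  rw [det_fin_two] at h2
  simp only [Matrix.sub_apply, map_apply, Matrix.smul_apply, one_apply_eq,
    smul_eq_mul, mul_one, ne_eq,
    one_ne_zero, zero_ne_one, not_false_eq_true, one_apply_ne, mul_zero, sub_zero] at h2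
  set t := (B : Matrix (Fin 2) (Fin 2) ℤ).trace with ht
  have htR : (t : ℝ) = (B 0 0 : ℤ) + (B 1 1 : ℤ) := by
    rw [ht, trace_fin_two]
    push_cast
    rfl
  have h3 : (2 * lam - t) ^ 2 = ((t ^ 2 - 4 : ℤ) : ℝ) := by
    push_cast
    rw [htR]
    linear_combination 4 * h2 - 4 * hd
  have h4 : √((t ^ 2 - 4 : ℤ) : ℝ) = |2 * lam - t| := by rw [← h3, Real.sqrt_sq_eq_abs]
  have two_mem : ∀ K : IntermediateField ℚ ℝ, (2 : ℝ) ∈ K := fun K => by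
    exact_mod_cast intCast_mem_field K 2
  apply le_antisymm
  · rw [IntermediateField.adjoin_simple_le_iff]
    have h5 : 2 * lam - t ∈ sqrtField (t ^ 2 - 4) := by
      have h6 := sqrt_mem_sqrtField (t ^ 2 - 4)
      rw [h4] at h6
      rcases abs_choice (2 * lam - t) with h | h <;> rw [h] at h6
      · exact h6
      · simpa using neg_mem h6
    have h7 := div_mem (add_mem h5 (intCast_mem_field _ t)) (two_mem _)
    simpa using h7
  · rw [sqrtField_le_iff, h4]
    have h5 : 2 * lam - t ∈ IntermediateField.adjoin ℚ {lam} :=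
      sub_mem (mul_mem (two_mem _) (IntermediateField.mem_adjoin_simple_self ℚ lam))
        (intCast_mem_field _ t)
    rcases abs_choice (2 * lam - t) with h | h <;> rw [h]
    · exact h5
    · exact neg_mem h5

theorem sqrtField_trace_eq_of_trace_eq {B₁ B₂ : SpecialLinearGroup (Fin 2) ℤ}
    (h₁ : 2 < (B₁ : Matrix (Fin 2) (Fin 2) ℤ).trace)
    (h₂ : 2 < (B₂ : Matrix (Fin 2) (Fin 2) ℤ).trace) {m n : ℤ} (hm : m ≠ 0) (hn : n ≠ 0)
    (h : ((B₁ ^ m : SpecialLinearGroup (Fin 2) ℤ) : Matrix (Fin 2) (Fin 2) ℤ).trace =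
      ((B₂ ^ n : SpecialLinearGroup (Fin 2) ℤ) : Matrix (Fin 2) (Fin 2) ℤ).trace) :
    sqrtField ((B₁ : Matrix (Fin 2) (Fin 2) ℤ).trace ^ 2 - 4) =
      sqrtField ((B₂ : Matrix (Fin 2) (Fin 2) ℤ).trace ^ 2 - 4) := by
  have key : ∀ {B : SpecialLinearGroup (Fin 2) ℤ} {k : ℤ},
      2 < (B : Matrix (Fin 2) (Fin 2) ℤ).trace → k ≠ 0 →
      sqrtField ((B : Matrix (Fin 2) (Fin 2) ℤ).trace ^ 2 - 4) = sqrtField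
        (((B ^ k : SpecialLinearGroup (Fin 2) ℤ) : Matrix (Fin 2) (Fin 2) ℤ).trace ^ 2 - 4) :=
    fun hB hk => sqrtField_eq_of_mul_sq_eq (lower_left_ne_zero (two_lt_trace_zpow hB hk))
      (lower_left_ne_zero hB) (disc_mul_sq_eq_of_commute (Commute.zpow_left rfl _)).symm
  rw [key h₁ hm, key h₂ hn, h]

/-! ### Pell's equation -/

/-- The reduction of B has finite order in the finite group SL(2, ℤ/N). -/
theorem exists_pow_congr_one (B : SpecialLinearGroup (Fin 2) ℤ) {N : ℤ} (hN : N ≠ 0) :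
    ∃ k : ℕ, k ≠ 0 ∧ N ∣ (B ^ k) 1 0 ∧
      N ∣ ((B ^ k : SpecialLinearGroup (Fin 2) ℤ) : Matrix (Fin 2) (Fin 2) ℤ).trace - 2 := by
  have : NeZero N.natAbs := ⟨Int.natAbs_ne_zero.2 hN⟩
  let ρ := Matrix.SpecialLinearGroup.map (n := Fin 2) (Int.castRingHom (ZMod N.natAbs))
  have hfin : Finite (SpecialLinearGroup (Fin 2) (ZMod N.natAbs)) := Subtype.finite
  obtain ⟨k, hk, hk1⟩ := isOfFinOrder_iff_pow_eq_one.1 (isOfFinOrder_of_finite (ρ B))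
  rw [← map_pow] at hk1
  have hentry : ∀ i j, (((B ^ k) i j : ℤ) : ZMod N.natAbs) =
      (1 : Matrix (Fin 2) (Fin 2) (ZMod N.natAbs)) i j := by
    intro i j
    have := congrArg (fun A : SpecialLinearGroup (Fin 2) (ZMod N.natAbs) => A i j) hk1
    exact this
  have hdvd : ∀ n : ℤ, (n : ZMod N.natAbs) = 0 → N ∣ n := fun n hn =>
    Int.natAbs_dvd.1 ((ZMod.intCast_zmod_eq_zero_iff_dvd n _).1 hn)
  refine ⟨k, hk.ne', hdvd _ ((hentry 1 0).trans (by simp)), hdvd _ ?_⟩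
  rw [trace_fin_two]
  push_cast
  rw [hentry, hentry, one_apply_eq, one_apply_eq]
  ring

theorem exists_pellSolution {B : SpecialLinearGroup (Fin 2) ℤ}
    (hB : 2 < (B : Matrix (Fin 2) (Fin 2) ℤ).trace) {e D : ℤ} (he : e ≠ 0)
    (hD : ((B : Matrix (Fin 2) (Fin 2) ℤ).trace ^ 2 - 4) * e ^ 2 = D) :
    ∃ (k : ℤ) (a : Pell.Solution₁ D), k ≠ 0 ∧ 1 < a.x ∧
      ((B ^ k : SpecialLinearGroup (Fin 2) ℤ) : Matrix (Fin 2) (Fin 2) ℤ).trace = 2 * a.x := by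
  have hc := lower_left_ne_zero hB
  -- If B ^ k ≡ 1 modulo this number, its trace is even, say 2x, and its lower-left entry is 2 e s
  -- times that of B. Comparing discriminants gives x² - 1 = D s².
  have hN : 2 * e * B 1 0 ≠ 0 := by positivity
  obtain ⟨k, hk, ⟨s, hs⟩, ⟨y, hy⟩⟩ := exists_pow_congr_one B hN
  have h1 := disc_mul_sq_eq_of_commute (X := B ^ k) (B := B) (Commute.pow_left rfl _)
  have h2 := two_lt_trace_zpow hB (m := k) (by exact_mod_cast hk)
  rw [zpow_natCast] at h2
  set T := ((B ^ k : SpecialLinearGroup (Fin 2) ℤ) : Matrix (Fin 2) (Fin 2) ℤ).trace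
  have hT : T = 2 * (e * B 1 0 * y + 1) := by linarith
  have h3 : (e * B 1 0 * y + 1) ^ 2 - D * s ^ 2 = 1 := by
    rw [hs, hT] at h1
    have h4 : 4 * B 1 0 ^ 2 ≠ 0 := by positivity
    apply mul_left_cancel₀ h4
    rw [← hD]
    linear_combination h1
  refine ⟨k, Pell.Solution₁.mk _ _ h3, by exact_mod_cast hk, ?_, ?_⟩
  · rw [Pell.Solution₁.x_mk]
    linarith
  · rw [Pell.Solution₁.x_mk, zpow_natCast]
    exact hT

/-- Traces of powers and x-coordinates of powers satisfy the same second-order recurrence, as a has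
norm 1. -/
theorem trace_zpow_eq {B : SpecialLinearGroup (Fin 2) ℤ} {D : ℤ} {a : Pell.Solution₁ D}
    (h : (B : Matrix (Fin 2) (Fin 2) ℤ).trace = 2 * a.x) (j : ℤ) :
    ((B ^ j : SpecialLinearGroup (Fin 2) ℤ) : Matrix (Fin 2) (Fin 2) ℤ).trace =
      2 * (a ^ j).x := by
  have key : ∀ n : ℕ,
      ((B ^ n : SpecialLinearGroup (Fin 2) ℤ) : Matrix (Fin 2) (Fin 2) ℤ).trace =
        2 * (a ^ n).x ∧
      ((B ^ (n + 1) : SpecialLinearGroup (Fin 2) ℤ) : Matrix (Fin 2) (Fin 2) ℤ).trace =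
        2 * (a ^ (n + 1)).x := by
    intro n
    induction n with
    | zero =>
      simp only [zero_add, pow_one, pow_zero, Matrix.SpecialLinearGroup.coe_one]
      exact ⟨by simp, h⟩
    | succ n ih =>
      refine ⟨ih.2, ?_⟩
      rw [trace_pow_add_two, ih.1, ih.2, h, pow_succ a (n + 1), pow_succ a n]
      simp only [Pell.Solution₁.x_mul, Pell.Solution₁.y_mul]
      linear_combination (2 * (a ^ n).x) * a.prop
  obtain ⟨n, rfl | rfl⟩ := j.eq_nat_or_neg
  · rw [zpow_natCast, zpow_natCast]
    exact (key n).1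
  · rw [_root_.zpow_neg, _root_.zpow_neg, zpow_natCast, zpow_natCast, trace_inv,
      Pell.Solution₁.x_inv]
    exact (key n).1

theorem exists_trace_eq_of_sqrtField_eq {B₁ B₂ : SpecialLinearGroup (Fin 2) ℤ}
    (h₁ : 2 < (B₁ : Matrix (Fin 2) (Fin 2) ℤ).trace)
    (h₂ : 2 < (B₂ : Matrix (Fin 2) (Fin 2) ℤ).trace)
    (h : sqrtField ((B₁ : Matrix (Fin 2) (Fin 2) ℤ).trace ^ 2 - 4) =
      sqrtField ((B₂ : Matrix (Fin 2) (Fin 2) ℤ).trace ^ 2 - 4)) :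
    ∃ m n : ℤ, m ≠ 0 ∧ n ≠ 0 ∧
      ((B₁ ^ m : SpecialLinearGroup (Fin 2) ℤ) : Matrix (Fin 2) (Fin 2) ℤ).trace =
        ((B₂ ^ n : SpecialLinearGroup (Fin 2) ℤ) : Matrix (Fin 2) (Fin 2) ℤ).trace := by
  obtain ⟨e, f, he, hf, hef⟩ := exists_mul_sq_eq_of_sqrtField_eq (by nlinarith) (by nlinarith)
    (not_isSquare_sq_sub_four h₁) (not_isSquare_sq_sub_four h₂) h
  obtain ⟨D, hD⟩ : ∃ D, ((B₁ : Matrix (Fin 2) (Fin 2) ℤ).trace ^ 2 - 4) * e ^ 2 = D := ⟨_, rfl⟩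
  obtain ⟨k₁, a₁, hk₁, hx₁, ha₁⟩ := exists_pellSolution h₁ he hD
  obtain ⟨k₂, a₂, hk₂, hx₂, ha₂⟩ := exists_pellSolution h₂ hf (hef.symm.trans hD)
  obtain ⟨u, hu⟩ := Pell.IsFundamental.exists_of_not_isSquare
    (Pell.Solution₁.d_pos_of_one_lt_x hx₁) (Pell.Solution₁.d_nonsquare_of_one_lt_x hx₁)
  -- Even exponents remove the sign in a = ±u ^ n; n = 0 would give a = ±1, against 1 < a.x.
  have key : ∀ a, 1 < a.x → ∃ n : ℤ, n ≠ 0 ∧ ∀ j : ℤ, a ^ (2 * j) = u ^ (2 * n * j) := by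
    intro a ha
    obtain ⟨n, hn⟩ := hu.eq_zpow_or_neg_zpow a
    refine ⟨n, ?_, fun j => ?_⟩
    · rintro rfl
      rcases hn with rfl | rfl <;> simp at ha
    · have h2 : a ^ (2 : ℤ) = u ^ (2 * n) := by
        rw [mul_comm, _root_.zpow_mul]
        rcases hn with rfl | rfl
        · rfl
        · exact even_two.neg_zpow _
      rw [_root_.zpow_mul, h2, ← _root_.zpow_mul]
  obtain ⟨n₁, hn₁, hu₁⟩ := key a₁ hx₁
  obtain ⟨n₂, hn₂, hu₂⟩ := key a₂ hx₂
  -- Both a₁ ^ (2 n₂) and a₂ ^ (2 n₁) equal u ^ (2 n₁ n₂).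
  refine ⟨k₁ * (2 * n₂), k₂ * (2 * n₁), by positivity, by positivity, ?_⟩
  rw [_root_.zpow_mul _ k₁, _root_.zpow_mul _ k₂, trace_zpow_eq ha₁, trace_zpow_eq ha₂, hu₁, hu₂,
    mul_right_comm 2 n₁]

theorem exists_matrix_of_realQuadraticField (K : RealQuadraticField) :
    ∃ B : SpecialLinearGroup (Fin 2) ℤ, 2 < (B : Matrix (Fin 2) (Fin 2) ℤ).trace ∧
      sqrtField ((B : Matrix (Fin 2) (Fin 2) ℤ).trace ^ 2 - 4) = K := by
  obtain ⟨d, hd, hsq, hK⟩ := exists_eq_sqrtField K.2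
  obtain ⟨a, hx, hy⟩ := Pell.Solution₁.exists_pos_of_not_isSquare hd hsq
  have hp := a.prop
  -- Multiplication by x + y√d in the basis 1, √d; its discriminant is 4x² - 4 = d (2y)².
  refine ⟨⟨!![a.x, d * a.y; a.y, a.x], by rw [det_fin_two_of, ← hp]; ring⟩, ?_, ?_⟩
  · change 2 < (!![a.x, d * a.y; a.y, a.x]).trace
    rw [trace_fin_two_of]
    linarith
  · change sqrtField ((!![a.x, d * a.y; a.y, a.x]).trace ^ 2 - 4) = _
    rw [trace_fin_two_of, hK]
    refine sqrtField_eq_of_mul_sq_eq (c₁ := 1) (c₂ := 2 * a.y) one_ne_zero (by positivity) ?_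
    linear_combination 4 * hp

/-! ### The bijection -/

theorem AbstractlyCommensurable.of_equiv {G₁ G₂ : Type*} [Group G₁] [Group G₂] (e : G₁ ≃* G₂) :
    AbstractlyCommensurable G₁ G₂ :=
  ⟨⊤, ⊤, inferInstance, inferInstance,
    ⟨Subgroup.topEquiv.trans (e.trans Subgroup.topEquiv.symm)⟩⟩

theorem commensurable_iff_sqrtField_eq {r₁ r₂ : ℕ} (hr₁ : 0 < r₁) (hr₂ : 0 < r₂)
    {B₁ B₂ : SpecialLinearGroup (Fin 2) ℤ} {l₁ l₂ : Fin 2 → ℤ}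
    (h₁ : 2 < (B₁ : Matrix (Fin 2) (Fin 2) ℤ).trace)
    (h₂ : 2 < (B₂ : Matrix (Fin 2) (Fin 2) ℤ).trace) {G₁ G₂ : Type*} [Group G₁] [Group G₂]
    (e₁ : G₁ ≃* Osc r₁ B₁ l₁) (e₂ : G₂ ≃* Osc r₂ B₂ l₂) :
    AbstractlyCommensurable G₁ G₂ ↔ sqrtField ((B₁ : Matrix (Fin 2) (Fin 2) ℤ).trace ^ 2 - 4) =
      sqrtField ((B₂ : Matrix (Fin 2) (Fin 2) ℤ).trace ^ 2 - 4) := by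
  have h3 : AbstractlyCommensurable G₁ G₂ ↔
      AbstractlyCommensurable (Osc r₁ B₁ l₁) (Osc r₂ B₂ l₂) :=
    ⟨fun h => (AbstractlyCommensurable.of_equiv e₁.symm).trans
      (h.trans (AbstractlyCommensurable.of_equiv e₂)),
      fun h => (AbstractlyCommensurable.of_equiv e₁).trans
        (h.trans (AbstractlyCommensurable.of_equiv e₂.symm))⟩
  rw [h3, abstractlyCommensurable_iff_powersConj hr₁ hr₂ l₁ l₂ h₁ h₂, powersConj_iff h₁ h₂]
  constructor
  · rintro ⟨m, n, hm, hn, h⟩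
    exact sqrtField_trace_eq_of_trace_eq h₁ h₂ hm hn h
  · exact exists_trace_eq_of_sqrtField_eq h₁ h₂

theorem exists_field_bijection : ∃ Φ : CommClass → RealQuadraticField,
    Function.Bijective Φ ∧
      ∀ (G : SplitOscGroup) (r : ℕ) (B : SpecialLinearGroup (Fin 2) ℤ) (l : Fin 2 → ℤ),
        0 < r → 2 < (B : Matrix (Fin 2) (Fin 2) ℤ).trace → Nonempty (G.carrier ≃* Osc r B l) →
        ∀ lam : ℝ, IsEigenvalue B lam →
          (Φ (Quotient.mk commSetoid G) : IntermediateField ℚ ℝ) =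
            IntermediateField.adjoin ℚ {lam} := by
  choose r B l hr hB e using fun G : SplitOscGroup => exists_equiv_osc G.isDiscreteSplitOscillator
  let F : SplitOscGroup → RealQuadraticField := fun G =>
    ⟨sqrtField ((B G : Matrix (Fin 2) (Fin 2) ℤ).trace ^ 2 - 4), finrank_sqrtField
      (by nlinarith [hB G]) (not_isSquare_sq_sub_four (hB G))⟩
  have hF : ∀ G₁ G₂ : SplitOscGroup,
      AbstractlyCommensurable G₁.carrier G₂.carrier ↔ F G₁ = F G₂ := fun G₁ G₂ =>
    (commensurable_iff_sqrtField_eq (hr G₁) (hr G₂) (hB G₁) (hB G₂) (e G₁).some (e G₂).some).trans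
      (Subtype.ext_iff (a1 := F G₁) (a2 := F G₂)).symm
  -- Independence of the chosen presentation: two presentations of G are compared through
  -- reflexivity of commensurability.
  have hFB : ∀ (G : SplitOscGroup) (r' : ℕ) (B' : SpecialLinearGroup (Fin 2) ℤ)
      (l' : Fin 2 → ℤ), 0 < r' → 2 < (B' : Matrix (Fin 2) (Fin 2) ℤ).trace →
      Nonempty (G.carrier ≃* Osc r' B' l') →
      (F G : IntermediateField ℚ ℝ) =
        sqrtField ((B' : Matrix (Fin 2) (Fin 2) ℤ).trace ^ 2 - 4) :=
    fun G r' B' l' hr' hB' ⟨e'⟩ =>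
      (commensurable_iff_sqrtField_eq (hr G) hr' (hB G) hB' (e G).some e').1 (.refl _)
  refine ⟨Quotient.lift F fun G₁ G₂ h => (hF G₁ G₂).1 h, ⟨?_, ?_⟩, ?_⟩
  · rintro ⟨G₁⟩ ⟨G₂⟩ h
    exact Quotient.sound ((hF G₁ G₂).2 h)
  · intro K
    obtain ⟨B', hB', hK⟩ := exists_matrix_of_realQuadraticField K
    let G : SplitOscGroup :=
      ⟨Osc 1 B' 0, isDiscreteSplitOscillator_osc one_pos 0 hB' (MulEquiv.refl _)⟩
    exact ⟨Quotient.mk _ G,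
      Subtype.ext ((hFB G 1 B' 0 one_pos hB' ⟨MulEquiv.refl _⟩).trans hK)⟩
  · intro G r' B' l' hr' hB' he lam hlam
    rw [adjoin_eigenvalue hlam]
    exact hFB G r' B' l' hr' hB' he

end SplitOsc

theorem theorem9p2 :
    -- the discrete split oscillator groups are, up to isomorphism, the groups `Osc^r(B, l)`
    (∀ (G : Type) [Group G], SplitOsc.IsDiscreteSplitOscillator G ↔
      ∃ (r : ℕ) (B : Matrix.SpecialLinearGroup (Fin 2) ℤ) (l : Fin 2 → ℤ),
        0 < r ∧ 2 < (B : Matrix (Fin 2) (Fin 2) ℤ).trace ∧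
          Nonempty (G ≃* SplitOsc.Osc r B l)) ∧
    -- `Osc^r(B, l) ↦ ℚ(λ(B))` induces a bijection from commensurability classes to real
    -- quadratic fields, where `λ(B)` is any eigenvalue of `B`
    (∃ Φ : SplitOsc.CommClass → SplitOsc.RealQuadraticField,
      Function.Bijective Φ ∧
      ∀ (G : SplitOsc.SplitOscGroup) (r : ℕ) (B : Matrix.SpecialLinearGroup (Fin 2) ℤ)
        (l : Fin 2 → ℤ), 0 < r → 2 < (B : Matrix (Fin 2) (Fin 2) ℤ).trace →
        Nonempty (G.carrier ≃* SplitOsc.Osc r B l) →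
        ∀ lam : ℝ, SplitOsc.IsEigenvalue B lam →
          (Φ (Quotient.mk SplitOsc.commSetoid G) : IntermediateField ℚ ℝ) =
            IntermediateField.adjoin ℚ {lam}) ∧
    -- commensurability of the groups in terms of the matrices
    (∀ (r₁ r₂ : ℕ) (B₁ B₂ : Matrix.SpecialLinearGroup (Fin 2) ℤ) (l₁ l₂ : Fin 2 → ℤ),
      0 < r₁ → 0 < r₂ → 2 < (B₁ : Matrix (Fin 2) (Fin 2) ℤ).trace →
      2 < (B₂ : Matrix (Fin 2) (Fin 2) ℤ).trace →
      (SplitOsc.AbstractlyCommensurable (SplitOsc.Osc r₁ B₁ l₁) (SplitOsc.Osc r₂ B₂ l₂) ↔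
        SplitOsc.PowersConj B₁ B₂)) :=
  ⟨fun _ _ => ⟨SplitOsc.exists_equiv_osc, fun ⟨_, _, l, hr, hB, ⟨e⟩⟩ =>
      SplitOsc.isDiscreteSplitOscillator_osc hr l hB e⟩,
    SplitOsc.exists_field_bijection,
    fun _ _ _ _ l₁ l₂ hr₁ hr₂ h₁ h₂ =>
      SplitOsc.abstractlyCommensurable_iff_powersConj hr₁ hr₂ l₁ l₂ h₁ h₂⟩
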